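/- \textbf{Setting.} Let $d\in\mathbb N$. For a bounded set $A\subset\mathbb R^d$ let its size $h_A$ be the diameter of the smallest ball containing $A$. A set $P$ is an \emph{$h$-covering} of $A\subset\mathbb R^d$ if every $x\in A$ lies in a $d$-simplex of size $<h$ with vertices in $P$. A finite set $P\subset\mathbb R^d$ has \emph{$h$-density bounded by $\tau$} if $\#(P\cap \bar B(x,h))\le\tau$ for every $x\in\mathbb R^d$. For a finite set $P=\{x_a : a\in I\}\subset\mathbb R^d$ of distinct points and $\beta>0$, the \emph{local maximum-entropy (LME) shape functions} $w_a^*$, $a\in I$, are defined at each $x$ in the convex hull of $P$ as the unique minimizer $(w_a^*(x))_{a\in I}$ of $$\sum_{a\in I} w_a|x-x_a|^2+\frac1\beta\sum_{a\in I}w_a\log w_a\qquad(0\log 0=0)$$ over all $(w_a)_{a\in I}\in\mathbb R^I$ with $w_a\ge0$, $\sum_a w_a=1$, $\sum_a w_a x_a=x$. \textbf{Theorem.} Let $\Omega\subset\mathbb R^d$ be a bounded open convex polyhedron (the interior of the convex hull of a finite set), let $\gamma,\tau>0$, and let $h_k>0$ with $h_k\to0$. For each $k$ let $P_k\subset\mathbb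 R^d$ be a finite set such that the interior of the convex hull of $P_k$ is $\Omega$, $P_k$ is an $h_k$-covering of $\Omega$, and $P_k$ has $h_k$-density bounded by $\tau$. Let $X_k$ be the linear span of the LME shape functions of $P_k$ with parameter $\beta_k=\gamma/h_k^2$. Let $1\le p<\infty$ and let $u\in W^{1,p}_0(\Omega)$, the closure of $C_c^\infty(\Omega)$ in $W^{1,p}(\Omega)$. Then there exist $u_k\in X_k\cap W^{1,p}(\Omega)$ (functions restricted to $\Omega$) such that $u_k\to u$ in $W^{1,p}(\Omega)$. -/

import Mathlib

open MeasureTheory Filter Topology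
open scoped ContDiff ENNReal

namespace LMEDensity

/-! ### Sobolev spaces -/

section Sobolev

variable {d : ℕ}

/-- `φ ∈ C_c^∞(Ω)`. -/
structure IsTestFunction (Ω : Set (EuclideanSpace ℝ (Fin d)))
    (φ : EuclideanSpace ℝ (Fin d) → ℝ) : Prop where
  smooth : ContDiff ℝ ∞ φ
  hasCompactSupport : HasCompactSupport φ
  tsupport_subset : tsupport φ ⊆ Ω

/-- `g` is a weak gradient of `u` on the open set `Ω`. -/
structure HasWeakGradient (Ω : Set (EuclideanSpace ℝ (Fin d)))
    (u : EuclideanSpace ℝ (Fin d) → ℝ)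
    (g : EuclideanSpace ℝ (Fin d) → EuclideanSpace ℝ (Fin d)) : Prop where
  locallyIntegrable : LocallyIntegrableOn u Ω
  locallyIntegrable_grad : LocallyIntegrableOn g Ω
  integral_eq : ∀ φ, IsTestFunction Ω φ → ∀ v : EuclideanSpace ℝ (Fin d),
    ∫ x in Ω, u x * fderiv ℝ φ x v = - ∫ x in Ω, inner ℝ (g x) v * φ x

/-- `u ∈ W^{1,p}(Ω)`. -/
def MemW1p (Ω : Set (EuclideanSpace ℝ (Fin d))) (p : ℝ≥0∞)
    (u : EuclideanSpace ℝ (Fin d) → ℝ) : Prop :=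
  MemLp u p (volume.restrict Ω) ∧
    ∃ g, HasWeakGradient Ω u g ∧ MemLp g p (volume.restrict Ω)

/-- The norm `‖u‖_{L^p(Ω)} + ‖∇u‖_{L^p(Ω)}` of `W^{1,p}(Ω)`. Weak gradients are unique up to
null sets, so the infimum is over one value; it is `∞` if there is no weak gradient. -/
noncomputable def w1pNorm (Ω : Set (EuclideanSpace ℝ (Fin d))) (p : ℝ≥0∞)
    (u : EuclideanSpace ℝ (Fin d) → ℝ) : ℝ≥0∞ :=
  ⨅ (g : EuclideanSpace ℝ (Fin d) → EuclideanSpace ℝ (Fin d)) (_ : HasWeakGradient Ω u g),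
    (eLpNorm u p (volume.restrict Ω) + eLpNorm g p (volume.restrict Ω))

/-- `u ∈ W^{1,p}_0(Ω)`, the closure of `C_c^∞(Ω)` in `W^{1,p}(Ω)`. -/
def MemW1p0 (Ω : Set (EuclideanSpace ℝ (Fin d))) (p : ℝ≥0∞)
    (u : EuclideanSpace ℝ (Fin d) → ℝ) : Prop :=
  MemW1p Ω p u ∧
    ∀ ε : ℝ≥0∞, 0 < ε → ∃ φ, IsTestFunction Ω φ ∧ w1pNorm Ω p (u - φ) < ε

end Sobolev

/-! ### Geometry of point sets -/

section Geometry

variable {d : ℕ}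

/-- The (open, bounded, convex) polyhedra: interiors of convex hulls of finitely many points. -/
def IsOpenPolytope (Ω : Set (EuclideanSpace ℝ (Fin d))) : Prop :=
  ∃ V : Finset (EuclideanSpace ℝ (Fin d)),
    Ω = interior (convexHull ℝ (V : Set (EuclideanSpace ℝ (Fin d))))

/-- The size of a bounded set: the diameter of the smallest ball that contains it. -/
noncomputable def setSize (A : Set (EuclideanSpace ℝ (Fin d))) : ℝ :=
  sInf {D : ℝ | 0 ≤ D ∧ ∃ c, A ⊆ Metric.closedBall c (D / 2)}

/-- `P` is an `h`-covering of `A`: each point of `A` lies in a `d`-simplex of size less than `h`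
with vertices in `P`. -/
def IsHCovering (P : Set (EuclideanSpace ℝ (Fin d))) (h : ℝ)
    (A : Set (EuclideanSpace ℝ (Fin d))) : Prop :=
  ∀ x ∈ A, ∃ T : Fin (d + 1) → EuclideanSpace ℝ (Fin d),
    AffineIndependent ℝ T ∧ (∀ i, T i ∈ P) ∧
    setSize (convexHull ℝ (Set.range T)) < h ∧ x ∈ convexHull ℝ (Set.range T)

/-- The finite set `P` has `h`-density bounded by `τ`. -/
def HasHDensityLE (P : Finset (EuclideanSpace ℝ (Fin d))) (h τ : ℝ) : Prop :=
  ∀ x : EuclideanSpace ℝ (Fin d),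
    (((P : Set (EuclideanSpace ℝ (Fin d))) ∩ Metric.closedBall x h).ncard : ℝ) ≤ τ

end Geometry

/-! ### Local maximum-entropy shape functions -/

section LME

variable {d : ℕ}

/-- The constraints: nonnegative weights on the nodes, first-order consistent at `x`. -/
def lmeFeasible (P : Finset (EuclideanSpace ℝ (Fin d))) (x : EuclideanSpace ℝ (Fin d)) :
    Set (P → ℝ) :=
  {w | (∀ a, 0 ≤ w a) ∧ ∑ a, w a = 1 ∧
    ∑ a, w a • (a : EuclideanSpace ℝ (Fin d)) = x}

/-- The objective `∑ w_a |x - x_a|² + β⁻¹ ∑ w_a log w_a` (with `0 log 0 = 0`). -/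
noncomputable def lmeObjective (P : Finset (EuclideanSpace ℝ (Fin d))) (β : ℝ)
    (x : EuclideanSpace ℝ (Fin d)) (w : P → ℝ) : ℝ :=
  ∑ a, w a * ‖x - (a : EuclideanSpace ℝ (Fin d))‖ ^ 2 +
    1 / β * ∑ a, w a * Real.log (w a)

/-- `w` solves the problem (LME) at the point `x`. -/
def IsLMESolution (P : Finset (EuclideanSpace ℝ (Fin d))) (β : ℝ)
    (x : EuclideanSpace ℝ (Fin d)) (w : P → ℝ) : Prop :=
  w ∈ lmeFeasible P x ∧ ∀ w' ∈ lmeFeasible P x, lmeObjective P β x w ≤ lmeObjective P β x w'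

theorem exists_isLMESolution {P : Finset (EuclideanSpace ℝ (Fin d))} (β : ℝ)
    {x : EuclideanSpace ℝ (Fin d)}
    (hx : x ∈ convexHull ℝ (P : Set (EuclideanSpace ℝ (Fin d)))) :
    ∃ w, IsLMESolution P β x w := by
  have hne : (lmeFeasible P x).Nonempty := by
    rw [Finset.mem_convexHull'] at hx
    obtain ⟨w, hw0, hw1, hwx⟩ := hx
    refine ⟨fun a => w a, fun a => hw0 a a.2, ?_, ?_⟩
    · rw [← hw1]; exact Finset.sum_coe_sort P w
    · rw [← hwx]; exact Finset.sum_coe_sort P (fun a => w a • a)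
  have hcpt : IsCompact (lmeFeasible P x) := by
    have : lmeFeasible P x = stdSimplex ℝ P ∩
        {w | ∑ a, w a • (a : EuclideanSpace ℝ (Fin d)) = x} := by
      ext w; simp [lmeFeasible, stdSimplex, and_assoc]
    rw [this]
    exact (isCompact_stdSimplex ℝ P).inter_right
      (isClosed_eq (by fun_prop) continuous_const)
  have hcont : Continuous (lmeObjective P β x) := by
    unfold lmeObjective
    refine Continuous.add (by fun_prop) (continuous_const.mul ?_)
    exact continuous_finsetSum _ fun a _ => Real.continuous_mul_log.comp (continuous_apply a)
  obtain ⟨w, hw, hmin⟩ := hcpt.exists_isMinOn hne hcont.continuousOn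
  exact ⟨w, hw, fun w' hw' => hmin hw'⟩

theorem isLMESolution_unique {P : Finset (EuclideanSpace ℝ (Fin d))} {β : ℝ} (hβ : 0 < β)
    {x : EuclideanSpace ℝ (Fin d)} {w w' : P → ℝ}
    (hw : IsLMESolution P β x w) (hw' : IsLMESolution P β x w') : w = w' := by
  by_contra hne
  obtain ⟨b, hb⟩ := Function.ne_iff.mp hne
  set m : P → ℝ := fun a => (1 / 2 : ℝ) * w a + (1 / 2 : ℝ) * w' a with hm
  have hfeas : m ∈ lmeFeasible P x := by
    obtain ⟨⟨h1, h2, h3⟩, -⟩ := hw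
    obtain ⟨⟨h1', h2', h3'⟩, -⟩ := hw'
    refine ⟨fun a => by have := h1 a; have := h1' a; simp only [hm]; positivity, ?_, ?_⟩
    · simp only [hm, Finset.sum_add_distrib, ← Finset.mul_sum, h2, h2']; norm_num
    · simp only [hm, add_smul, mul_smul, Finset.sum_add_distrib, ← Finset.smul_sum, h3, h3']
      rw [← add_smul]; norm_num
  have hent : ∑ a, m a * Real.log (m a) <
      ∑ a, ((1 / 2 : ℝ) * (w a * Real.log (w a)) + (1 / 2 : ℝ) * (w' a * Real.log (w' a))) := by
    refine Finset.sum_lt_sum (fun a _ => ?_) ⟨b, Finset.mem_univ _, ?_⟩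
    · exact Real.convexOn_mul_log.2 (hw.1.1 a) (hw'.1.1 a)
        (by norm_num : (0 : ℝ) ≤ 1 / 2) (by norm_num) (by norm_num)
    · exact Real.strictConvexOn_mul_log.2 (hw.1.1 b) (hw'.1.1 b) hb
        (by norm_num : (0 : ℝ) < 1 / 2) (by norm_num) (by norm_num)
  have hlin : ∑ a, m a * ‖x - (a : EuclideanSpace ℝ (Fin d))‖ ^ 2 =
      (1 / 2 : ℝ) * ∑ a, w a * ‖x - (a : EuclideanSpace ℝ (Fin d))‖ ^ 2 +
      (1 / 2 : ℝ) * ∑ a, w' a * ‖x - (a : EuclideanSpace ℝ (Fin d))‖ ^ 2 := by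
    rw [Finset.mul_sum, Finset.mul_sum, ← Finset.sum_add_distrib]
    exact Finset.sum_congr rfl fun a _ => by simp only [hm]; ring
  rw [Finset.sum_add_distrib, ← Finset.mul_sum, ← Finset.mul_sum] at hent
  have h1 := hw.2 m hfeas
  have h2 := hw'.2 m hfeas
  have h3 := mul_lt_mul_of_pos_left hent (one_div_pos.mpr hβ)
  simp only [lmeObjective, hlin] at h1 h2
  linarith

open Classical in
/-- The LME shape functions: `lmeShape P β x a = w_a^*(x)`, the solution of (LME) at `x`. For
`β > 0` it exists and is unique for each `x` in the convex hull of `P`; outside the hull the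
problem is infeasible and the value `0` is a mere convention. -/
noncomputable def lmeShape (P : Finset (EuclideanSpace ℝ (Fin d))) (β : ℝ)
    (x : EuclideanSpace ℝ (Fin d)) : P → ℝ :=
  if h : ∃ w, IsLMESolution P β x w then h.choose else 0

theorem lmeShape_spec {P : Finset (EuclideanSpace ℝ (Fin d))} (β : ℝ)
    {x : EuclideanSpace ℝ (Fin d)}
    (hx : x ∈ convexHull ℝ (P : Set (EuclideanSpace ℝ (Fin d)))) :
    IsLMESolution P β x (lmeShape P β x) := by
  have h := exists_isLMESolution β hx
  rw [lmeShape, dif_pos h]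
  exact h.choose_spec

/-- The span `X` of the shape functions. -/
noncomputable def lmeSpace (P : Finset (EuclideanSpace ℝ (Fin d))) (β : ℝ) :
    Submodule ℝ (EuclideanSpace ℝ (Fin d) → ℝ) :=
  Submodule.span ℝ (Set.range fun (a : P) (x : EuclideanSpace ℝ (Fin d)) => lmeShape P β x a)

end LME

end LMEDensity

/-! Completing the square turns the LME problem at `x` into minimizing a relative entropy. If the
normalized Gaussian weights `exp (-β |a - z|²) / Z` centred at `z` have barycentre `x`, then on the
feasible set the objective is, up to a constant, `1/β` times the entropy relative to these weights.
They are therefore the minimizer. Such a `z` exists for every `x` in the interior of the hull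
(`exists_gibbsMean_eq`). The map `z ↦ x` has derivative `2β` times the covariance of the weights.
The inverse function theorem then shows that combinations of shape functions are `C¹` in `Ω`, with
derivative in direction `f` equal to `∑ c_a w_a ⟪a - x, e⟫`, where `e` solves `Cov e = f`
(`exists_gibbs_lmeShape`).

By definition of `W^{1,p}_0` it suffices to approximate a test function `φ`, here by its interpolant
`∑ φ(a) w_a`. Since `Ω` is bounded, uniform convergence of values and gradients is enough
(`exists_uniform_approx`). The difficulty is that the covariance has no uniform lower bound near the
boundary. The proof distinguishes whether the centre `z`, rather than `x`, is close to the support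
of `φ`.

If `z` is close to the support, there are nodes on all sides of it at distance of order `h`. The
covariance is then at least of order `h²`, the third moment is at most of order `h³`, and Taylor
expansion gives an error of order `h` (`exists_gibbs_moment_bounds`).

If `z` is at distance at least `δ` from the support, then `x` lies outside the support
(`le_of_le_norm_sub_gibbsMean`), so both `φ` and its gradient vanish at `x`. For a node `a` in the
support, two separated nodes closer to `z` have weights larger than `w_a` by a factor `exp (c δ² /
h²)`. These two nodes alone make the covariance large relative to `w_a`, so that `w_a ⟪a - x, e⟫` is
exponentially small even where the covariance degenerates (`sq_gibbs_mul_inner_le_of_far`). There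
are only `O(h^{-d})` nodes, so the sum of these terms tends to zero. -/

namespace LMEDensity

/-! ### Weak gradients and the Sobolev norm. -/

section SobolevLemmas

variable {d : ℕ} {Ω : Set (EuclideanSpace ℝ (Fin d))} {p : ℝ≥0∞}

/-- Shape functions are regular only inside `Ω`. Multiplying by a function supported in `Ω` makes
the product regular everywhere, so that integration by parts can be done on the whole space. -/
theorem continuous_mul_of_tsupport_subset {X : Type*} [TopologicalSpace X] {U : Set X}
    (hU : IsOpen U) {f g : X → ℝ} (hf : ContinuousOn f U) (hg : Continuous g)
    (hgU : tsupport g ⊆ U) : Continuous fun x => f x * g x := by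
  rw [continuous_iff_continuousAt]
  intro x
  by_cases hx : x ∈ tsupport g
  · exact (hf.continuousAt (hU.mem_nhds (hgU hx))).mul hg.continuousAt
  · have h0 : (fun x => f x * g x) =ᶠ[𝓝 x] fun _ => 0 := by
      filter_upwards [(isClosed_tsupport g).isOpen_compl.mem_nhds hx] with y hy
      rw [image_eq_zero_of_notMem_tsupport hy, mul_zero]
    exact h0.continuousAt

theorem integrable_mul_of_tsupport_subset (hΩ : IsOpen Ω)
    {f g : EuclideanSpace ℝ (Fin d) → ℝ} (hf : ContinuousOn f Ω) (hg : Continuous g)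
    (hc : HasCompactSupport g) (hgU : tsupport g ⊆ Ω) : Integrable fun x => f x * g x :=
  (continuous_mul_of_tsupport_subset hΩ hf hg hgU).integrable_of_hasCompactSupport hc.mul_left

/-- The classical gradient of a `C¹` function is its weak gradient. -/
theorem hasWeakGradient_gradient (hΩ : IsOpen Ω) {v : EuclideanSpace ℝ (Fin d) → ℝ}
    (hv : ∀ x ∈ Ω, ContDiffAt ℝ 1 v x) : HasWeakGradient Ω v (gradient v) := by
  have hvc : ContinuousOn v Ω := fun x hx => (hv x hx).continuousAt.continuousWithinAt
  have hdc : ContinuousOn (fderiv ℝ v) Ω := fun x hx =>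
    ((hv x hx).fderiv_right (m := 0) (by norm_num)).continuousAt.continuousWithinAt
  have hgc : ContinuousOn (gradient v) Ω :=
    (InnerProductSpace.toDual ℝ (EuclideanSpace ℝ (Fin d))).symm.continuous.comp_continuousOn hdc
  refine ⟨hvc.locallyIntegrableOn hΩ.measurableSet, hgc.locallyIntegrableOn hΩ.measurableSet, ?_⟩
  intro φ hφ w
  have hdφ : Continuous fun x => fderiv ℝ φ x w :=
    (hφ.smooth.continuous_fderiv (by simp)).clm_apply continuous_const
  have hcφ : HasCompactSupport fun x => fderiv ℝ φ x w := hφ.hasCompactSupport.fderiv_apply ℝ w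
  have hsφ : tsupport (fun x => fderiv ℝ φ x w) ⊆ Ω :=
    (tsupport_fderiv_apply_subset ℝ w).trans hφ.tsupport_subset
  have hvw : ContinuousOn (fun x => fderiv ℝ v x w) Ω := hdc.clm_apply continuousOn_const
  have key := integral_mul_fderiv_eq_neg_fderiv_mul_of_integrable (μ := volume) (f := v) (g := φ)
    (v := w)
    (integrable_mul_of_tsupport_subset hΩ hvw hφ.smooth.continuous hφ.hasCompactSupport
      hφ.tsupport_subset)
    (integrable_mul_of_tsupport_subset hΩ hvc hdφ hcφ hsφ)
    (integrable_mul_of_tsupport_subset hΩ hvc hφ.smooth.continuous hφ.hasCompactSupport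
      hφ.tsupport_subset)
    (fun x hx => (hv x (hφ.tsupport_subset hx)).differentiableAt (by norm_num))
    (fun x _ => hφ.smooth.contDiffAt.differentiableAt (by simp))
  simp only [inner_gradient_left]
  rw [setIntegral_eq_integral_of_forall_compl_eq_zero fun x hx => ?_,
    setIntegral_eq_integral_of_forall_compl_eq_zero fun x hx => ?_, key]
  · rw [image_eq_zero_of_notMem_tsupport fun h => hx (hφ.tsupport_subset h), mul_zero]
  · rw [image_eq_zero_of_notMem_tsupport (f := fun x => fderiv ℝ φ x w) fun h => hx (hsφ h),
      mul_zero]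

theorem integrableOn_mul_of_tsupport_subset (hΩ : IsOpen Ω) {u φ : EuclideanSpace ℝ (Fin d) → ℝ}
    (hu : LocallyIntegrableOn u Ω) (hφ : Continuous φ) (hc : HasCompactSupport φ)
    (hs : tsupport φ ⊆ Ω) : IntegrableOn (fun x => u x * φ x) Ω := by
  have h1 : IntegrableOn (fun x => u x * φ x) (tsupport φ) :=
    (hu.integrableOn_compact_subset hs hc).mul_continuousOn hφ.continuousOn hc
  refine h1.of_forall_sdiff_eq_zero hΩ.measurableSet fun x hx => ?_
  rw [image_eq_zero_of_notMem_tsupport hx.2, mul_zero]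

theorem HasWeakGradient.sub (hΩ : IsOpen Ω) {u v : EuclideanSpace ℝ (Fin d) → ℝ}
    {f g : EuclideanSpace ℝ (Fin d) → EuclideanSpace ℝ (Fin d)}
    (hu : HasWeakGradient Ω u f) (hv : HasWeakGradient Ω v g) :
    HasWeakGradient Ω (u - v) (f - g) := by
  refine ⟨hu.locallyIntegrable.sub hv.locallyIntegrable,
    hu.locallyIntegrable_grad.sub hv.locallyIntegrable_grad, fun φ hφ w => ?_⟩
  have hdφ : Continuous fun x => fderiv ℝ φ x w :=
    (hφ.smooth.continuous_fderiv (by simp)).clm_apply continuous_const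
  have hcφ : HasCompactSupport fun x => fderiv ℝ φ x w := hφ.hasCompactSupport.fderiv_apply ℝ w
  have hsφ : tsupport (fun x => fderiv ℝ φ x w) ⊆ Ω :=
    (tsupport_fderiv_apply_subset ℝ w).trans hφ.tsupport_subset
  have hin : ∀ k : EuclideanSpace ℝ (Fin d) → EuclideanSpace ℝ (Fin d),
      LocallyIntegrableOn k Ω → LocallyIntegrableOn (fun x => inner ℝ (k x) w) Ω :=
    fun k hk x hx => by
      obtain ⟨s, hs, hks⟩ := hk x hx
      exact ⟨s, hs, hks.inner_const w⟩
  have i1 := integrableOn_mul_of_tsupport_subset hΩ hu.locallyIntegrable hdφ hcφ hsφ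
  have i2 := integrableOn_mul_of_tsupport_subset hΩ hv.locallyIntegrable hdφ hcφ hsφ
  have j1 := integrableOn_mul_of_tsupport_subset hΩ (hin f hu.locallyIntegrable_grad)
    hφ.smooth.continuous hφ.hasCompactSupport hφ.tsupport_subset
  have j2 := integrableOn_mul_of_tsupport_subset hΩ (hin g hv.locallyIntegrable_grad)
    hφ.smooth.continuous hφ.hasCompactSupport hφ.tsupport_subset
  have e1 := integral_sub i1 i2
  have e2 := integral_sub j1 j2
  simp only [Pi.sub_apply, inner_sub_left, sub_mul]
  rw [e1, e2, hu.integral_eq φ hφ w, hv.integral_eq φ hφ w]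
  ring

theorem HasWeakGradient.zero : HasWeakGradient Ω 0 0 :=
  ⟨locallyIntegrableOn_zero, locallyIntegrableOn_zero, fun φ _ w => by simp⟩

theorem HasWeakGradient.aestronglyMeasurable
    {u : EuclideanSpace ℝ (Fin d) → ℝ}
    {g : EuclideanSpace ℝ (Fin d) → EuclideanSpace ℝ (Fin d)} (h : HasWeakGradient Ω u g) :
    AEStronglyMeasurable u (volume.restrict Ω) ∧ AEStronglyMeasurable g (volume.restrict Ω) :=
  ⟨h.locallyIntegrable.aestronglyMeasurable, h.locallyIntegrable_grad.aestronglyMeasurable⟩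

theorem w1pNorm_le {u : EuclideanSpace ℝ (Fin d) → ℝ}
    {g : EuclideanSpace ℝ (Fin d) → EuclideanSpace ℝ (Fin d)} (h : HasWeakGradient Ω u g) :
    w1pNorm Ω p u ≤ eLpNorm u p (volume.restrict Ω) + eLpNorm g p (volume.restrict Ω) :=
  iInf₂_le g h

/-- No membership in `W^{1,p}` is needed: if one function has no weak gradient, the right-hand side
is an infimum over the empty set, hence `∞`. -/
theorem w1pNorm_sub_le (hΩ : IsOpen Ω) (hp : 1 ≤ p) (u v : EuclideanSpace ℝ (Fin d) → ℝ) :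
    w1pNorm Ω p (u - v) ≤ w1pNorm Ω p u + w1pNorm Ω p v := by
  conv_rhs => rw [w1pNorm, w1pNorm]
  refine ENNReal.le_iInf₂_add_iInf₂ fun f hf g hg => ?_
  have hu := hf.aestronglyMeasurable
  have hv := hg.aestronglyMeasurable
  calc w1pNorm Ω p (u - v) ≤ _ := w1pNorm_le (hf.sub hΩ hg)
    _ ≤ (eLpNorm u p (volume.restrict Ω) + eLpNorm v p (volume.restrict Ω)) +
        (eLpNorm f p (volume.restrict Ω) + eLpNorm g p (volume.restrict Ω)) :=
      add_le_add (eLpNorm_sub_le hu.1 hv.1 hp) (eLpNorm_sub_le hu.2 hv.2 hp)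
    _ = _ := add_add_add_comm _ _ _ _

end SobolevLemmas

/-! ### Shape functions as Gaussian weights, and their derivatives. -/

section GibbsWeights

variable {d : ℕ}

/-- The partition function of the Gaussian weights centred at `z`. -/
noncomputable def gibbsSum (P : Finset (EuclideanSpace ℝ (Fin d))) (β : ℝ)
    (z : EuclideanSpace ℝ (Fin d)) : ℝ :=
  ∑ a : P, Real.exp (-β * ‖(a : EuclideanSpace ℝ (Fin d)) - z‖ ^ 2)

/-- The normalized Gaussian weights centred at `z`. -/
noncomputable def gibbs (P : Finset (EuclideanSpace ℝ (Fin d))) (β : ℝ)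
    (z : EuclideanSpace ℝ (Fin d)) (a : P) : ℝ :=
  Real.exp (-β * ‖(a : EuclideanSpace ℝ (Fin d)) - z‖ ^ 2) / gibbsSum P β z

/-- The barycentre of the normalized Gaussian weights centred at `z`. -/
noncomputable def gibbsMean (P : Finset (EuclideanSpace ℝ (Fin d))) (β : ℝ)
    (z : EuclideanSpace ℝ (Fin d)) : EuclideanSpace ℝ (Fin d) :=
  ∑ a : P, gibbs P β z a • (a : EuclideanSpace ℝ (Fin d))

variable {P : Finset (EuclideanSpace ℝ (Fin d))} {β : ℝ}

theorem gibbsSum_pos (hP : P.Nonempty) (β : ℝ) (z : EuclideanSpace ℝ (Fin d)) :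
    0 < gibbsSum P β z := by
  have : Nonempty P := hP.to_subtype
  exact Finset.sum_pos (fun a _ => Real.exp_pos _) Finset.univ_nonempty

theorem gibbs_pos (hP : P.Nonempty) (β : ℝ) (z : EuclideanSpace ℝ (Fin d)) (a : P) :
    0 < gibbs P β z a :=
  div_pos (Real.exp_pos _) (gibbsSum_pos hP β z)

theorem sum_gibbs (hP : P.Nonempty) (β : ℝ) (z : EuclideanSpace ℝ (Fin d)) :
    ∑ a, gibbs P β z a = 1 := by
  simp only [gibbs, ← Finset.sum_div]
  exact div_self (gibbsSum_pos hP β z).ne'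

theorem gibbs_le_one (hP : P.Nonempty) (β : ℝ) (z : EuclideanSpace ℝ (Fin d)) (a : P) :
    gibbs P β z a ≤ 1 := by
  rw [← sum_gibbs hP β z]
  exact Finset.single_le_sum (fun b _ => (gibbs_pos hP β z b).le) (Finset.mem_univ a)

theorem sum_gibbs_smul_sub (hP : P.Nonempty) {x z : EuclideanSpace ℝ (Fin d)}
    (hx : gibbsMean P β z = x) :
    ∑ a, gibbs P β z a • ((a : EuclideanSpace ℝ (Fin d)) - x) = 0 := by
  simp only [smul_sub, Finset.sum_sub_distrib, ← Finset.sum_smul, sum_gibbs hP]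
  rw [one_smul, ← hx, gibbsMean, sub_self]

theorem sum_gibbs_inner_sub (hP : P.Nonempty) {x z : EuclideanSpace ℝ (Fin d)}
    (hx : gibbsMean P β z = x) (e : EuclideanSpace ℝ (Fin d)) :
    ∑ a, gibbs P β z a * inner ℝ ((a : EuclideanSpace ℝ (Fin d)) - x) e = 0 := by
  have h := congrArg (fun y => inner ℝ y e) (sum_gibbs_smul_sub hP hx)
  simpa [sum_inner, real_inner_smul_left] using h

/-- Expand `|a - z|²` around `x`: the cross term is linear in `a - x` and averages to zero under
feasible weights. What remains is a relative entropy plus terms independent of `w`. -/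
theorem lmeObjective_eq_gibbs (hP : P.Nonempty) (hβ : 0 < β) (x z : EuclideanSpace ℝ (Fin d))
    {w : P → ℝ} (hw : w ∈ lmeFeasible P x) :
    lmeObjective P β x w =
      1 / β * ∑ a, (w a * Real.log (w a) - w a * Real.log (gibbs P β z a)) -
        ‖x - z‖ ^ 2 - 1 / β * Real.log (gibbsSum P β z) := by
  obtain ⟨-, h1, h2⟩ := hw
  have hlog : ∀ a : P, Real.log (gibbs P β z a) =
      -β * (‖x - a‖ ^ 2 + 2 * inner ℝ ((a : EuclideanSpace ℝ (Fin d)) - x) (x - z)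
        + ‖x - z‖ ^ 2) - Real.log (gibbsSum P β z) := fun a => by
    have : (a : EuclideanSpace ℝ (Fin d)) - z = (a - x) + (x - z) := by abel
    rw [gibbs, Real.log_div (Real.exp_ne_zero _) (gibbsSum_pos hP β z).ne', Real.log_exp, this,
      norm_add_sq_real, norm_sub_rev x a]
  have hin : ∑ a : P, w a * inner ℝ ((a : EuclideanSpace ℝ (Fin d)) - x) (x - z) = 0 := by
    have : ∑ a : P, w a • ((a : EuclideanSpace ℝ (Fin d)) - x) = 0 := by
      simp only [smul_sub, Finset.sum_sub_distrib, ← Finset.sum_smul, h1, h2, one_smul, sub_self]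
    have h := congrArg (fun y => inner ℝ y (x - z)) this
    simpa [sum_inner, real_inner_smul_left] using h
  have hsum : ∑ a, w a * Real.log (gibbs P β z a) =
      -β * ∑ a, w a * ‖x - a‖ ^ 2 - β * ‖x - z‖ ^ 2 - Real.log (gibbsSum P β z) := by
    calc ∑ a, w a * Real.log (gibbs P β z a)
        = ∑ a : P, (-β * (w a * ‖x - a‖ ^ 2)
            + -2 * β * (w a * inner ℝ ((a : EuclideanSpace ℝ (Fin d)) - x) (x - z))
            + (-β * ‖x - z‖ ^ 2 - Real.log (gibbsSum P β z)) * w a) :=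
          Finset.sum_congr rfl fun a _ => by rw [hlog]; ring
      _ = _ := by
          rw [Finset.sum_add_distrib, Finset.sum_add_distrib, ← Finset.mul_sum, ← Finset.mul_sum,
            ← Finset.mul_sum, hin, h1]
          ring
  rw [Finset.sum_sub_distrib, hsum, lmeObjective]
  field_simp
  ring

theorem isLMESolution_gibbs (hP : P.Nonempty) (hβ : 0 < β) {x z : EuclideanSpace ℝ (Fin d)}
    (hx : gibbsMean P β z = x) : IsLMESolution P β x (gibbs P β z) := by
  have hf : gibbs P β z ∈ lmeFeasible P x :=
    ⟨fun a => (gibbs_pos hP β z a).le, sum_gibbs hP β z, hx⟩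
  refine ⟨hf, fun w hw => ?_⟩
  rw [lmeObjective_eq_gibbs hP hβ x z hf, lmeObjective_eq_gibbs hP hβ x z hw]
  have h0 : ∑ a, (gibbs P β z a * Real.log (gibbs P β z a)
      - gibbs P β z a * Real.log (gibbs P β z a)) = 0 := by simp
  -- Gibbs' inequality, from `log t ≤ t - 1` at `t = gibbs / w`; a vanishing weight is treated
  -- separately.
  have h1 : 0 ≤ ∑ a, (w a * Real.log (w a) - w a * Real.log (gibbs P β z a)) := by
    have : ∑ a, (w a - gibbs P β z a) ≤
        ∑ a, (w a * Real.log (w a) - w a * Real.log (gibbs P β z a)) := by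
      refine Finset.sum_le_sum fun a _ => ?_
      have hg := gibbs_pos hP β z a
      rcases (hw.1 a).eq_or_lt with h | h
      · rw [← h]; simp [hg.le]
      · have := Real.log_le_sub_one_of_pos (div_pos hg h)
        rw [Real.log_div hg.ne' h.ne'] at this
        have h2 := mul_le_mul_of_nonneg_left this h.le
        have h3 : w a * (gibbs P β z a / w a - 1) = gibbs P β z a - w a := by field_simp
        rw [h3] at h2
        linarith
    rwa [Finset.sum_sub_distrib, hw.2.1, sum_gibbs hP, sub_self] at this
  rw [h0, mul_zero]
  have := mul_nonneg (one_div_pos.mpr hβ).le h1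
  linarith

theorem lmeShape_eq_gibbs (hP : P.Nonempty) (hβ : 0 < β) {x z : EuclideanSpace ℝ (Fin d)}
    (hx : gibbsMean P β z = x) : lmeShape P β x = gibbs P β z := by
  have hs := isLMESolution_gibbs hP hβ hx
  refine isLMESolution_unique hβ ?_ hs
  have h : ∃ w, IsLMESolution P β x w := ⟨_, hs⟩
  rw [lmeShape, dif_pos h]
  exact h.choose_spec

/-- A linear functional on the hull is maximized at a node, and the hull contains a ball about `x`.
This quantitative form of interiority gives both coercivity of the dual problem and nondegeneracy of
the covariance. -/
theorem exists_inner_sub_ge {x : EuclideanSpace ℝ (Fin d)}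
    (hx : x ∈ interior (convexHull ℝ (P : Set (EuclideanSpace ℝ (Fin d))))) :
    ∃ r : ℝ, 0 < r ∧ ∀ e : EuclideanSpace ℝ (Fin d),
      ∃ a : P, r * ‖e‖ ≤ inner ℝ ((a : EuclideanSpace ℝ (Fin d)) - x) e := by
  rw [mem_interior_iff_mem_nhds] at hx
  obtain ⟨r, hr, hrx⟩ := Metric.nhds_basis_closedBall.mem_iff.mp hx
  refine ⟨r, hr, fun e => ?_⟩
  have hmem : x + (r * ‖e‖⁻¹) • e ∈ convexHull ℝ (P : Set (EuclideanSpace ℝ (Fin d))) := by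
    refine hrx ?_
    rw [mem_closedBall_iff_norm, add_sub_cancel_left, norm_smul, Real.norm_eq_abs,
      abs_of_nonneg (by positivity), mul_assoc]
    exact mul_le_of_le_one_right hr.le (inv_mul_le_one)
  have hconv : ConvexOn ℝ Set.univ fun y : EuclideanSpace ℝ (Fin d) => inner ℝ y e :=
    ((innerₗ (EuclideanSpace ℝ (Fin d))).flip e).convexOn convex_univ
  obtain ⟨a, ha, hle⟩ := hconv.exists_ge_of_mem_convexHull (Set.subset_univ _) hmem
  refine ⟨⟨a, ha⟩, ?_⟩
  rw [inner_add_left, real_inner_smul_left, real_inner_self_eq_norm_sq] at hle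
  rw [inner_sub_left]
  have : r * ‖e‖⁻¹ * ‖e‖ ^ 2 = r * ‖e‖ := by
    by_cases h : ‖e‖ = 0
    · simp [h]
    · field_simp
  linarith

theorem nonempty_of_mem_interior_convexHull {x : EuclideanSpace ℝ (Fin d)}
    (hx : x ∈ interior (convexHull ℝ (P : Set (EuclideanSpace ℝ (Fin d))))) : P.Nonempty := by
  have h := interior_subset hx
  have : (convexHull ℝ (P : Set (EuclideanSpace ℝ (Fin d)))).Nonempty := ⟨x, h⟩
  simpa using this

/-- Every interior point of the convex hull is the barycentre of Gaussian weights. -/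
theorem exists_gibbsMean_eq (hβ : 0 < β) {x : EuclideanSpace ℝ (Fin d)}
    (hx : x ∈ interior (convexHull ℝ (P : Set (EuclideanSpace ℝ (Fin d))))) :
    ∃ z, gibbsMean P β z = x := by
  have hP := nonempty_of_mem_interior_convexHull hx
  obtain ⟨r, hr, hin⟩ := exists_inner_sub_ge hx
  -- The dual function of the LME problem, without its logarithm. It is coercive because in each
  -- direction `μ` some node satisfies `⟪a - x, μ⟫ ≥ r ‖μ‖`; the vanishing of its gradient at a
  -- minimizer is the barycentre condition.
  set F : EuclideanSpace ℝ (Fin d) → ℝ := fun μ => ∑ a : P,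
    Real.exp (-β * ‖(a : EuclideanSpace ℝ (Fin d)) - x‖ ^ 2 +
      2 * β * inner ℝ ((a : EuclideanSpace ℝ (Fin d)) - x) μ) with hF
  have hcont : Continuous F := by rw [hF]; fun_prop
  have hlow : ∀ μ, Real.exp (-β * ∑ a : P, ‖(a : EuclideanSpace ℝ (Fin d)) - x‖ ^ 2 +
      2 * β * (r * ‖μ‖)) ≤ F μ := fun μ => by
    obtain ⟨a, ha⟩ := hin μ
    refine le_trans ?_ (Finset.single_le_sum (fun b _ => (Real.exp_pos _).le) (Finset.mem_univ a))
    refine Real.exp_le_exp.mpr (add_le_add ?_ ?_)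
    · refine mul_le_mul_of_nonpos_left ?_ (by linarith)
      exact Finset.single_le_sum (f := fun a : P => ‖(a : EuclideanSpace ℝ (Fin d)) - x‖ ^ 2)
        (fun b _ => by positivity) (Finset.mem_univ a)
    · exact mul_le_mul_of_nonneg_left ha (by linarith)
  have htend : Tendsto F (cocompact _) atTop := by
    refine tendsto_atTop_mono hlow (Real.tendsto_exp_atTop.comp ?_)
    refine tendsto_atTop_add_const_left _ _ ?_
    refine Tendsto.const_mul_atTop (by linarith) ?_
    exact tendsto_norm_cocompact_atTop.const_mul_atTop hr
  obtain ⟨μ, hμ⟩ := hcont.exists_forall_le htend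
  have hderiv : HasFDerivAt F (∑ a : P,
    Real.exp (-β * ‖(a : EuclideanSpace ℝ (Fin d)) - x‖ ^ 2 +
      2 * β * inner ℝ ((a : EuclideanSpace ℝ (Fin d)) - x) μ) •
      ((2 * β) • innerSL ℝ ((a : EuclideanSpace ℝ (Fin d)) - x))) μ := by
    refine HasFDerivAt.fun_sum fun a _ => HasFDerivAt.exp ?_
    exact ((innerSL ℝ ((a : EuclideanSpace ℝ (Fin d)) - x)).hasFDerivAt.const_mul (2 * β)).const_add _
  have hzero := (IsLocalMin.hasFDerivAt_eq_zero (Eventually.of_forall hμ) hderiv)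
  have hvec : ∑ a : P, Real.exp (-β * ‖(a : EuclideanSpace ℝ (Fin d)) - x‖ ^ 2 +
      2 * β * inner ℝ ((a : EuclideanSpace ℝ (Fin d)) - x) μ) •
      ((a : EuclideanSpace ℝ (Fin d)) - x) = 0 := by
    refine ext_inner_right ℝ fun e => ?_
    have h := DFunLike.congr_fun hzero e
    simp only [sum_apply, smul_apply, innerSL_apply_apply,
      smul_eq_mul, zero_apply] at h
    have h2 : (2 * β) * ∑ a : P, Real.exp (-β * ‖(a : EuclideanSpace ℝ (Fin d)) - x‖ ^ 2 +
      2 * β * inner ℝ ((a : EuclideanSpace ℝ (Fin d)) - x) μ) *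
        inner ℝ ((a : EuclideanSpace ℝ (Fin d)) - x) e = 0 := by
      rw [Finset.mul_sum, ← h]
      exact Finset.sum_congr rfl fun a _ => by ring
    rw [sum_inner, inner_zero_left]
    simp only [real_inner_smul_left]
    exact (mul_eq_zero.mp h2).resolve_left (by linarith)
  -- Completing the square in the exponent of `F` moves the centre from `x` to `x + μ`, at the cost
  -- of a factor common to all nodes.
  refine ⟨x + μ, ?_⟩
  have hw : ∀ a : P, gibbs P β (x + μ) a =
      (Real.exp (-β * ‖μ‖ ^ 2) / gibbsSum P β (x + μ)) *
      Real.exp (-β * ‖(a : EuclideanSpace ℝ (Fin d)) - x‖ ^ 2 +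
      2 * β * inner ℝ ((a : EuclideanSpace ℝ (Fin d)) - x) μ) := fun a => by
    rw [gibbs, div_mul_eq_mul_div, ← Real.exp_add, ← sub_sub, norm_sub_sq_real]
    congr 2
    ring
  have hsub : ∑ a : P, gibbs P β (x + μ) a • ((a : EuclideanSpace ℝ (Fin d)) - x) = 0 := by
    simp only [hw, mul_smul]
    rw [← Finset.smul_sum, hvec, smul_zero]
  simp only [smul_sub, Finset.sum_sub_distrib, ← Finset.sum_smul, sum_gibbs hP, one_smul] at hsub
  exact sub_eq_zero.mp hsub

theorem contDiff_gibbs (hP : P.Nonempty) (a : P) : ContDiff ℝ 1 fun z => gibbs P β z a := by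
  have h : ∀ b : P, ContDiff ℝ 1 fun z : EuclideanSpace ℝ (Fin d) =>
      Real.exp (-β * ‖(b : EuclideanSpace ℝ (Fin d)) - z‖ ^ 2) := fun b =>
    (contDiff_const.mul ((contDiff_const.sub contDiff_id).norm_sq ℝ)).exp
  exact (h a).div (ContDiff.sum fun b _ => h b) fun z => (gibbsSum_pos hP β z).ne'

/-- Differentiating the normalization replaces `a - z` by `a` minus the barycentre. This is why the
covariance appears in the derivative of `gibbsMean`. -/
theorem hasFDerivAt_gibbs (hP : P.Nonempty) (z : EuclideanSpace ℝ (Fin d)) (a : P) :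
    HasFDerivAt (fun z => gibbs P β z a) ((2 * β * gibbs P β z a) •
      innerSL ℝ ((a : EuclideanSpace ℝ (Fin d)) - gibbsMean P β z)) z := by
  have hexp : ∀ b : P, HasFDerivAt (fun z : EuclideanSpace ℝ (Fin d) =>
      Real.exp (-β * ‖(b : EuclideanSpace ℝ (Fin d)) - z‖ ^ 2))
      ((2 * β * Real.exp (-β * ‖(b : EuclideanSpace ℝ (Fin d)) - z‖ ^ 2)) •
        innerSL ℝ ((b : EuclideanSpace ℝ (Fin d)) - z)) z := fun b => by
    have h1 := (((hasFDerivAt_id z).const_sub (b : EuclideanSpace ℝ (Fin d))).norm_sq.const_mul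
      (-β)).exp
    refine h1.congr_fderiv ?_
    ext e
    simp
    ring
  have hsum : HasFDerivAt (gibbsSum P β) (∑ b : P,
      (2 * β * Real.exp (-β * ‖(b : EuclideanSpace ℝ (Fin d)) - z‖ ^ 2)) •
        innerSL ℝ ((b : EuclideanSpace ℝ (Fin d)) - z)) z :=
    HasFDerivAt.fun_sum fun b _ => hexp b
  have hZ := (gibbsSum_pos hP β z).ne'
  have hdiv := (hexp a).fun_mul ((hasDerivAt_inv hZ).comp_hasFDerivAt z hsum)
  simp only [gibbs, div_eq_mul_inv]
  refine hdiv.congr_fderiv ?_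
  have hmean : ∑ b : P, Real.exp (-β * ‖(b : EuclideanSpace ℝ (Fin d)) - z‖ ^ 2) •
      ((b : EuclideanSpace ℝ (Fin d)) - z) = gibbsSum P β z • (gibbsMean P β z - z) := by
    have : ∀ b : P, Real.exp (-β * ‖(b : EuclideanSpace ℝ (Fin d)) - z‖ ^ 2) =
        gibbsSum P β z * gibbs P β z b := fun b => by rw [gibbs]; field_simp
    simp only [this, mul_smul, ← Finset.smul_sum, smul_sub, Finset.sum_sub_distrib,
      ← Finset.sum_smul, sum_gibbs hP, one_smul]
    rfl
  ext e
  have hm := congrArg (fun y => inner ℝ y e) hmean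
  simp only [sum_inner, real_inner_smul_left, neg_mul] at hm
  simp only [add_apply, smul_apply, neg_mul, neg_smul, neg_apply,
    sum_apply, innerSL_apply_apply, smul_eq_mul, mul_assoc, Function.comp_apply]
  rw [← Finset.mul_sum, ← Finset.mul_sum, hm, inner_sub_left, inner_sub_left, inner_sub_left]
  field_simp
  ring

/-- The shape functions at an interior point of the hull: they are Gaussian weights, and their
combinations are differentiable, with derivatives expressed through the covariance. -/
theorem exists_gibbs_lmeShape (hβ : 0 < β) {x : EuclideanSpace ℝ (Fin d)}
    (hx : x ∈ interior (convexHull ℝ (P : Set (EuclideanSpace ℝ (Fin d))))) :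
    ∃ z, gibbsMean P β z = x ∧ lmeShape P β x = gibbs P β z ∧ ∀ c : P → ℝ,
      ContDiffAt ℝ 1 (fun y => ∑ a, c a * lmeShape P β y a) x ∧
      ∀ f : EuclideanSpace ℝ (Fin d), ∃ e : EuclideanSpace ℝ (Fin d),
        ∑ a, (gibbs P β z a * inner ℝ ((a : EuclideanSpace ℝ (Fin d)) - x) e) •
          ((a : EuclideanSpace ℝ (Fin d)) - x) = f ∧
        fderiv ℝ (fun y => ∑ a, c a * lmeShape P β y a) x f =
          ∑ a, c a * (gibbs P β z a * inner ℝ ((a : EuclideanSpace ℝ (Fin d)) - x) e) := by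
  have hP := nonempty_of_mem_interior_convexHull hx
  obtain ⟨z, hz⟩ := exists_gibbsMean_eq hβ hx
  refine ⟨z, hz, lmeShape_eq_gibbs hP hβ hz, ?_⟩
  have hCD : ContDiff ℝ 1 (gibbsMean P β) :=
    ContDiff.sum fun a _ => (contDiff_gibbs hP a).smul contDiff_const
  set M : EuclideanSpace ℝ (Fin d) →L[ℝ] EuclideanSpace ℝ (Fin d) :=
    ∑ a : P, ((2 * β * gibbs P β z a) •
      innerSL ℝ ((a : EuclideanSpace ℝ (Fin d)) - x)).smulRight
        (a : EuclideanSpace ℝ (Fin d)) with hM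
  have hMderiv : HasFDerivAt (gibbsMean P β) M z := by
    refine HasFDerivAt.fun_sum fun a _ => ?_
    have := (hasFDerivAt_gibbs (β := β) hP z a).smul_const (a : EuclideanSpace ℝ (Fin d))
    rwa [hz] at this
  have hMapply : ∀ e, M e = ∑ a : P,
      (gibbs P β z a * inner ℝ ((a : EuclideanSpace ℝ (Fin d)) - x) ((2 * β) • e)) •
        ((a : EuclideanSpace ℝ (Fin d)) - x) := fun e => by
    simp only [smul_sub, Finset.sum_sub_distrib, ← Finset.sum_smul]
    rw [sum_gibbs_inner_sub hP hz, zero_smul, sub_zero, hM]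
    simp only [sum_apply, ContinuousLinearMap.smulRight_apply,
      smul_apply, innerSL_apply_apply, smul_eq_mul, real_inner_smul_right]
    exact Finset.sum_congr rfl fun a _ => by congr 1; ring
  -- `M` is `2β` times the covariance. If `M e = 0`, the variance in direction `e` vanishes; all
  -- weights are positive, so every `⟪a - x, e⟫` is zero, and interiority forces `e = 0`.
  have hinj : Function.Injective M := by
    rw [injective_iff_map_eq_zero]
    intro e he
    have h1 : ∑ a : P, gibbs P β z a *
        (inner ℝ ((a : EuclideanSpace ℝ (Fin d)) - x) e) ^ 2 = 0 := by
      have h := congrArg (fun y => inner ℝ y e) ((hMapply e).symm.trans he)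
      simp only [sum_inner, real_inner_smul_left, inner_zero_left, real_inner_smul_right] at h
      have h2 : (2 * β) * ∑ a : P, gibbs P β z a *
          (inner ℝ ((a : EuclideanSpace ℝ (Fin d)) - x) e) ^ 2 = 0 := by
        rw [← h, Finset.mul_sum]
        exact Finset.sum_congr rfl fun a _ => by ring
      exact (mul_eq_zero.mp h2).resolve_left (by linarith)
    rw [Finset.sum_eq_zero_iff_of_nonneg fun a _ =>
      mul_nonneg (gibbs_pos hP β z a).le (sq_nonneg _)] at h1
    obtain ⟨r, hr, hin⟩ := exists_inner_sub_ge hx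
    obtain ⟨a, ha⟩ := hin e
    have h2 := h1 a (Finset.mem_univ a)
    rw [mul_eq_zero, or_iff_right (gibbs_pos hP β z a).ne', sq_eq_zero_iff] at h2
    rw [h2] at ha
    have : ‖e‖ ≤ 0 := by
      by_contra hcon
      push Not at hcon
      nlinarith
    simpa using this
  set L : EuclideanSpace ℝ (Fin d) ≃L[ℝ] EuclideanSpace ℝ (Fin d) :=
    (LinearEquiv.ofInjectiveEndo (M : EuclideanSpace ℝ (Fin d) →ₗ[ℝ] EuclideanSpace ℝ (Fin d))
      hinj).toContinuousLinearEquiv with hL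
  have hLM : (L : EuclideanSpace ℝ (Fin d) →L[ℝ] EuclideanSpace ℝ (Fin d)) = M := by
    ext1 e; rfl
  have hLderiv : HasFDerivAt (gibbsMean P β)
      (L : EuclideanSpace ℝ (Fin d) →L[ℝ] EuclideanSpace ℝ (Fin d)) z := hLM ▸ hMderiv
  set g := hCD.contDiffAt.localInverse hLderiv (by norm_num)
  have hgC : ContDiffAt ℝ 1 g x := by
    have := hCD.contDiffAt.to_localInverse hLderiv (by norm_num)
    rwa [hz] at this
  have hgz : g x = z := by
    have := hCD.contDiffAt.localInverse_apply_image hLderiv (by norm_num)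
    rwa [hz] at this
  have hgr : ∀ᶠ y in 𝓝 x, gibbsMean P β (g y) = y := by
    have := (hCD.contDiffAt.hasStrictFDerivAt' hLderiv (by norm_num)).eventually_right_inverse
    rwa [hz] at this
  have hgd : HasFDerivAt g
      (L.symm : EuclideanSpace ℝ (Fin d) →L[ℝ] EuclideanSpace ℝ (Fin d)) x := by
    have := (hCD.contDiffAt.hasStrictFDerivAt' hLderiv (by norm_num)).to_localInverse.hasFDerivAt
    rwa [hz] at this
  intro c
  have hev : (fun y => ∑ a, c a * lmeShape P β y a) =ᶠ[𝓝 x]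
      fun y => ∑ a, c a * gibbs P β (g y) a := by
    filter_upwards [hgr] with y hy
    rw [lmeShape_eq_gibbs hP hβ hy]
  -- The factor `2β` passes from the derivative to `e`, so that `e` is the inverse covariance
  -- applied to `f`, without `β`.
  refine ⟨?_, fun f => ⟨(2 * β) • L.symm f, ?_, ?_⟩⟩
  · refine ContDiffAt.congr_of_eventuallyEq ?_ hev
    exact ContDiffAt.sum fun a _ =>
      contDiffAt_const.mul ((contDiff_gibbs hP a).contDiffAt.comp x hgC)
  · rw [← hMapply, ← hLM]
    exact L.apply_symm_apply f
  · rw [hev.fderiv_eq]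
    have hd : HasFDerivAt (fun y => ∑ a, c a * gibbs P β (g y) a) _ x :=
      HasFDerivAt.fun_sum fun a _ =>
        HasFDerivAt.const_mul (HasFDerivAt.comp x (hgz ▸ hasFDerivAt_gibbs hP z a) hgd) (c a)
    rw [hd.fderiv]
    simp only [sum_apply, smul_apply, hgz, hz,
      ContinuousLinearMap.comp_apply, innerSL_apply_apply, smul_eq_mul, real_inner_smul_right]
    refine Finset.sum_congr rfl fun a _ => ?_
    simp only [ContinuousLinearEquiv.coe_coe]
    ring

end GibbsWeights

/-! ### Counting nodes by comparison with Gaussian integrals. -/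

section Counting

variable {d : ℕ}

theorem integrable_exp_neg_mul_sq_norm_sub {b : ℝ} (hb : 0 < b) (z : EuclideanSpace ℝ (Fin d)) :
    Integrable fun y : EuclideanSpace ℝ (Fin d) => Real.exp (-b * ‖y - z‖ ^ 2) := by
  have h0 : Integrable fun y : EuclideanSpace ℝ (Fin d) => Real.exp (-b * ‖y‖ ^ 2) := by
    refine Integrable.of_integral_ne_zero ?_
    rw [GaussianFourier.integral_rexp_neg_mul_sq_norm hb]
    have := Real.pi_pos
    positivity
  exact h0.comp_sub_right z

/-- Spread each term over the ball of radius `h` about its node. There `|y - z|² ≤ 2|a - z|² + 2h²`,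
so a Gaussian of half the exponent dominates the term. The density bound says that at most `τ` such
balls overlap at a point. -/
theorem volume_mul_sum_exp_le {P : Finset (EuclideanSpace ℝ (Fin d))} {h τ c : ℝ}
    (hP : HasHDensityLE P h τ) (hc : 0 < c) (z : EuclideanSpace ℝ (Fin d)) :
    volume.real (Metric.closedBall (0 : EuclideanSpace ℝ (Fin d)) h) *
      ∑ a : P, Real.exp (-c * ‖(a : EuclideanSpace ℝ (Fin d)) - z‖ ^ 2) ≤
    τ * (Real.exp (c * h ^ 2) * (Real.pi / (c / 2)) ^ (d / 2 : ℝ)) := by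
  classical
  set G : EuclideanSpace ℝ (Fin d) → ℝ :=
    fun y => Real.exp (c * h ^ 2) * Real.exp (-(c / 2) * ‖y - z‖ ^ 2) with hG
  have hGi : Integrable G := (integrable_exp_neg_mul_sq_norm_sub (half_pos hc) z).const_mul _
  have hGint : ∫ y, G y = Real.exp (c * h ^ 2) * (Real.pi / (c / 2)) ^ (d / 2 : ℝ) := by
    rw [hG, integral_const_mul,
      integral_sub_right_eq_self (fun y : EuclideanSpace ℝ (Fin d) =>
        Real.exp (-(c / 2) * ‖y‖ ^ 2)) z,
      GaussianFourier.integral_rexp_neg_mul_sq_norm (half_pos hc), finrank_euclideanSpace_fin]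
  have hind : ∀ a : P, Integrable
      ((Metric.closedBall (a : EuclideanSpace ℝ (Fin d)) h).indicator G) := fun a =>
    hGi.indicator Metric.isClosed_closedBall.measurableSet
  have hterm : ∀ a : P, volume.real (Metric.closedBall (0 : EuclideanSpace ℝ (Fin d)) h) *
      Real.exp (-c * ‖(a : EuclideanSpace ℝ (Fin d)) - z‖ ^ 2) ≤
      ∫ y, (Metric.closedBall (a : EuclideanSpace ℝ (Fin d)) h).indicator G y := fun a => by
    rw [integral_indicator Metric.isClosed_closedBall.measurableSet,
      ← Measure.addHaar_real_closedBall_center volume (a : EuclideanSpace ℝ (Fin d)) h,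
      ← smul_eq_mul, ← setIntegral_const]
    refine setIntegral_mono_on ?_ hGi.integrableOn Metric.isClosed_closedBall.measurableSet ?_
    · exact integrableOn_const (isCompact_closedBall _ _).measure_lt_top.ne
    · intro y hy
      rw [hG]
      simp only
      rw [← Real.exp_add]
      refine Real.exp_le_exp.mpr ?_
      rw [mem_closedBall_iff_norm] at hy
      have h1 : ‖y - z‖ ≤ ‖(a : EuclideanSpace ℝ (Fin d)) - z‖ + h := by
        calc ‖y - z‖ = ‖(y - a) + (a - z)‖ := by rw [sub_add_sub_cancel]
          _ ≤ ‖y - a‖ + ‖(a : EuclideanSpace ℝ (Fin d)) - z‖ := norm_add_le _ _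
          _ ≤ _ := by linarith
      have h2 : ‖y - z‖ ^ 2 ≤ 2 * ‖(a : EuclideanSpace ℝ (Fin d)) - z‖ ^ 2 + 2 * h ^ 2 := by
        nlinarith [norm_nonneg (y - z), sq_nonneg (‖(a : EuclideanSpace ℝ (Fin d)) - z‖ - h)]
      nlinarith
  have hpt : ∀ y, ∑ a : P, (Metric.closedBall (a : EuclideanSpace ℝ (Fin d)) h).indicator G y
      ≤ τ * G y := fun y => by
    have hG0 : 0 ≤ G y := by rw [hG]; positivity
    have h1 : ∑ a : P, (Metric.closedBall (a : EuclideanSpace ℝ (Fin d)) h).indicator G y =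
        (((P : Set (EuclideanSpace ℝ (Fin d))) ∩ Metric.closedBall y h).ncard : ℝ) * G y := by
      have : (P : Set (EuclideanSpace ℝ (Fin d))) ∩ Metric.closedBall y h =
          ((P.filter fun a => a ∈ Metric.closedBall y h : Finset _) : Set _) := by
        ext a; simp
      rw [this, Set.ncard_coe_finset, ← nsmul_eq_mul, ← Finset.sum_const, Finset.sum_filter,
        ← Finset.sum_coe_sort P]
      refine Finset.sum_congr rfl fun a _ => ?_
      rw [Set.indicator_apply]
      simp only [Metric.mem_closedBall_comm]
    rw [h1]
    exact mul_le_mul_of_nonneg_right (hP y) hG0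
  calc _ = ∑ a : P, volume.real (Metric.closedBall (0 : EuclideanSpace ℝ (Fin d)) h) *
      Real.exp (-c * ‖(a : EuclideanSpace ℝ (Fin d)) - z‖ ^ 2) := Finset.mul_sum _ _ _
    _ ≤ ∑ a : P, ∫ y, (Metric.closedBall (a : EuclideanSpace ℝ (Fin d)) h).indicator G y :=
      Finset.sum_le_sum fun a _ => hterm a
    _ = ∫ y, ∑ a : P, (Metric.closedBall (a : EuclideanSpace ℝ (Fin d)) h).indicator G y :=
      (integral_finsetSum _ fun a _ => hind a).symm
    _ ≤ ∫ y, τ * G y :=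
      integral_mono (integrable_finsetSum _ fun a _ => hind a) (hGi.const_mul τ) hpt
    _ = _ := by rw [integral_const_mul, hGint]

theorem volume_real_closedBall_eq {h : ℝ} (hh : 0 ≤ h) :
    volume.real (Metric.closedBall (0 : EuclideanSpace ℝ (Fin d)) h) =
      h ^ d * volume.real (Metric.ball (0 : EuclideanSpace ℝ (Fin d)) 1) := by
  rw [Measure.addHaar_real_closedBall volume _ hh, finrank_euclideanSpace_fin]

theorem volume_real_unitBall_pos :
    0 < volume.real (Metric.ball (0 : EuclideanSpace ℝ (Fin d)) 1) :=
  ENNReal.toReal_pos (Metric.measure_ball_pos _ _ one_pos).ne' measure_ball_lt_top.ne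

/-- At Gaussian width proportional to `h`, the integral scales like `h^d` and cancels the volume of
the ball, so the bound does not depend on `h`. -/
theorem exists_sum_exp_le (d : ℕ) {γ τ : ℝ} (hγ : 0 < γ) (hτ : 0 < τ) :
    ∃ C : ℝ, 0 < C ∧ ∀ (P : Finset (EuclideanSpace ℝ (Fin d))) (h : ℝ), 0 < h →
      HasHDensityLE P h τ → ∀ z : EuclideanSpace ℝ (Fin d),
      ∑ a : P, Real.exp (-(γ / 2) * (‖(a : EuclideanSpace ℝ (Fin d)) - z‖ / h) ^ 2) ≤ C := by
  have hV := volume_real_unitBall_pos (d := d)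
  have hπ := Real.pi_pos
  refine ⟨τ * (Real.exp (γ / 2) * (4 * Real.pi / γ) ^ (d / 2 : ℝ)) /
    volume.real (Metric.ball (0 : EuclideanSpace ℝ (Fin d)) 1), by positivity, ?_⟩
  intro P h hh hP z
  have hmain := volume_mul_sum_exp_le hP (c := γ / 2 / h ^ 2) (by positivity) z
  rw [volume_real_closedBall_eq hh.le] at hmain
  have e1 : γ / 2 / h ^ 2 * h ^ 2 = γ / 2 := by field_simp
  have e2 : (Real.pi / (γ / 2 / h ^ 2 / 2)) ^ (d / 2 : ℝ) =
      (4 * Real.pi / γ) ^ (d / 2 : ℝ) * h ^ d := by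
    have : Real.pi / (γ / 2 / h ^ 2 / 2) = 4 * Real.pi / γ * h ^ 2 := by field_simp; norm_num
    rw [this, Real.mul_rpow (by positivity) (by positivity), ← Real.rpow_natCast h 2,
      ← Real.rpow_mul hh.le, ← Real.rpow_natCast h d]
    congr 2
    push_cast
    ring
  rw [e1, e2] at hmain
  have e3 : ∀ a : P, -(γ / 2) * (‖(a : EuclideanSpace ℝ (Fin d)) - z‖ / h) ^ 2 =
      -(γ / 2 / h ^ 2) * ‖(a : EuclideanSpace ℝ (Fin d)) - z‖ ^ 2 := fun a => by
    rw [div_pow]; ring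
  simp only [e3]
  rw [le_div_iff₀ hV]
  have hhd : 0 < h ^ d := by positivity
  refine le_of_mul_le_mul_left ?_ hhd
  linarith

/-- The same comparison with a Gaussian of fixed width centred at the origin, which is bounded below
on the ball of radius `R`. -/
theorem exists_card_le (d : ℕ) {τ : ℝ} (hτ : 0 < τ) (R : ℝ) :
    ∃ C : ℝ, 0 < C ∧ ∀ (P : Finset (EuclideanSpace ℝ (Fin d))) (h : ℝ), 0 < h → h ≤ 1 →
      HasHDensityLE P h τ → (∀ a ∈ P, ‖a‖ ≤ R) → (P.card : ℝ) ≤ C / h ^ d := by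
  have hV := volume_real_unitBall_pos (d := d)
  have hπ := Real.pi_pos
  refine ⟨τ * (Real.exp 1 * (Real.pi / (1 / 2)) ^ (d / 2 : ℝ)) /
    volume.real (Metric.ball (0 : EuclideanSpace ℝ (Fin d)) 1) * Real.exp (R ^ 2),
    by positivity, ?_⟩
  intro P h hh hh1 hP hR
  have hmain := volume_mul_sum_exp_le hP one_pos 0
  rw [volume_real_closedBall_eq hh.le] at hmain
  have h1 : (P.card : ℝ) * Real.exp (-R ^ 2) ≤
      ∑ a : P, Real.exp (-1 * ‖(a : EuclideanSpace ℝ (Fin d)) - 0‖ ^ 2) := by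
    have : ∑ a : P, Real.exp (-R ^ 2) = (P.card : ℝ) * Real.exp (-R ^ 2) := by simp
    rw [← this]
    refine Finset.sum_le_sum fun a _ => Real.exp_le_exp.mpr ?_
    rw [sub_zero]
    have := hR a a.2
    nlinarith [norm_nonneg (a : EuclideanSpace ℝ (Fin d))]
  have h2 : Real.exp (1 * h ^ 2) ≤ Real.exp 1 := Real.exp_le_exp.mpr (by nlinarith)
  have h3 : τ * (Real.exp (1 * h ^ 2) * (Real.pi / (1 / 2)) ^ (d / 2 : ℝ)) ≤
      τ * (Real.exp 1 * (Real.pi / (1 / 2)) ^ (d / 2 : ℝ)) := by gcongr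
  have hhd : 0 < h ^ d := by positivity
  have h4 := (mul_le_mul_of_nonneg_left h1 (mul_pos hhd hV).le).trans (hmain.trans h3)
  generalize τ * (Real.exp 1 * (Real.pi / (1 / 2)) ^ (d / 2 : ℝ)) = K at h4 ⊢
  rw [Real.exp_neg] at h4
  have hE := Real.exp_pos (R ^ 2)
  rw [le_div_iff₀ hhd, div_mul_eq_mul_div, le_div_iff₀ hV]
  field_simp at h4
  linarith

theorem IsHCovering.exists_norm_sub_le {P A : Set (EuclideanSpace ℝ (Fin d))} {h : ℝ}
    (hP : IsHCovering P h A) {x : EuclideanSpace ℝ (Fin d)} (hx : x ∈ A) :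
    ∃ a ∈ P, ‖a - x‖ ≤ h := by
  obtain ⟨T, -, hTP, hsize, hxT⟩ := hP x hx
  -- The infimum of the empty set is `0` by convention, so an admissible diameter below `h` can be
  -- extracted only after nonemptiness is known.
  have hne : {D : ℝ | 0 ≤ D ∧ ∃ c, convexHull ℝ (Set.range T) ⊆
      Metric.closedBall c (D / 2)}.Nonempty := by
    have hb : Bornology.IsBounded (convexHull ℝ (Set.range T)) :=
      isBounded_convexHull.mpr (Set.finite_range T).isBounded
    obtain ⟨r, hr, hsub⟩ := hb.subset_closedBall_lt 0 0
    exact ⟨2 * r, by linarith, 0, by rwa [mul_div_cancel_left₀ _ two_ne_zero]⟩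
  obtain ⟨D, ⟨-, c, hc⟩, hDh⟩ := exists_lt_of_csInf_lt hne hsize
  refine ⟨T 0, hTP 0, ?_⟩
  have h1 := hc hxT
  have h2 := hc (subset_convexHull ℝ _ ⟨0, rfl⟩)
  rw [← dist_eq_norm]
  calc dist (T 0) x ≤ dist (T 0) c + dist x c := dist_triangle_right _ _ _
    _ ≤ D / 2 + D / 2 := add_le_add h2 h1
    _ ≤ h := by linarith

end Counting

/-! ### Exponential smallness of weights far from the centre. -/

section WeightEstimates

variable {d : ℕ} {P : Finset (EuclideanSpace ℝ (Fin d))} {Ω : Set (EuclideanSpace ℝ (Fin d))}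
  {β h δ : ℝ} {x z e f : EuclideanSpace ℝ (Fin d)}

/-- Two nodes of weight at least `W` bound the variance from below, by `(s - t)² ≤ 2(s² + t²)`.
Every lower bound on the covariance comes from such a pair. -/
theorem mul_sq_inner_sub_le (hP : P.Nonempty) {W : ℝ} (hW : 0 ≤ W) {b b' : P}
    (hb : W ≤ gibbs P β z b) (hb' : W ≤ gibbs P β z b') :
    W * inner ℝ ((b : EuclideanSpace ℝ (Fin d)) - b') e ^ 2 ≤
      2 * ∑ a, gibbs P β z a * inner ℝ ((a : EuclideanSpace ℝ (Fin d)) - x) e ^ 2 := by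
  have hnn : ∀ a : P, 0 ≤ gibbs P β z a *
      inner ℝ ((a : EuclideanSpace ℝ (Fin d)) - x) e ^ 2 := fun a =>
    mul_nonneg (gibbs_pos hP β z a).le (sq_nonneg _)
  by_cases hbb : b = b'
  · rw [hbb, sub_self, inner_zero_left]
    have := Finset.sum_nonneg fun a (_ : a ∈ Finset.univ) => hnn a
    simpa using this
  · have h1 := Finset.sum_le_sum_of_subset_of_nonneg (Finset.subset_univ {b, b'})
      fun a _ _ => hnn a
    rw [Finset.sum_pair hbb] at h1
    have h2 : inner ℝ ((b : EuclideanSpace ℝ (Fin d)) - b') e =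
        inner ℝ ((b : EuclideanSpace ℝ (Fin d)) - x) e -
        inner ℝ ((b' : EuclideanSpace ℝ (Fin d)) - x) e := by
      rw [← inner_sub_left, sub_sub_sub_cancel_right]
    rw [h2]
    generalize inner ℝ ((b : EuclideanSpace ℝ (Fin d)) - x) e = s at *
    generalize inner ℝ ((b' : EuclideanSpace ℝ (Fin d)) - x) e = t at *
    have h3 := mul_le_mul_of_nonneg_right hb (sq_nonneg s)
    have h4 := mul_le_mul_of_nonneg_right hb' (sq_nonneg t)
    have h5 := mul_nonneg hW (sq_nonneg (s + t))
    nlinarith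

theorem sum_gibbs_mul_sq_inner
    (hf : ∑ a, (gibbs P β z a * inner ℝ ((a : EuclideanSpace ℝ (Fin d)) - x) e) •
      ((a : EuclideanSpace ℝ (Fin d)) - x) = f) :
    ∑ a, gibbs P β z a * inner ℝ ((a : EuclideanSpace ℝ (Fin d)) - x) e ^ 2 = inner ℝ f e := by
  rw [← hf, sum_inner]
  exact Finset.sum_congr rfl fun a _ => by rw [real_inner_smul_left]; ring

/-- A node that is closer to `z` than a given one, in a direction that may be perturbed. -/
theorem exists_node_closer (hnode : ∀ y ∈ Ω, ∃ a : P, ‖(a : EuclideanSpace ℝ (Fin d)) - y‖ ≤ h)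
    (hδ : 0 < δ) (hhδ : h ≤ δ / 64) {a : EuclideanSpace ℝ (Fin d)}
    (ha : Metric.closedBall a δ ⊆ Ω) (haz : δ ≤ ‖a - z‖) (he : ‖e‖ ≤ 1) :
    ∃ b : P, ‖(b : EuclideanSpace ℝ (Fin d)) - z‖ ≤ ‖a - z‖ - δ / 32 ∧
      ‖(b : EuclideanSpace ℝ (Fin d)) -
        (a + (δ / 4) • (‖z - a‖⁻¹ • (z - a) + (1 / 2 : ℝ) • e))‖ ≤ h := by
  rw [norm_sub_rev a z] at haz ⊢
  set R := ‖z - a‖ with hR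
  have hR0 : 0 < R := hδ.trans_le haz
  set n := R⁻¹ • (z - a) with hn
  have hn1 : ‖n‖ = 1 := by rw [hn, norm_smul, norm_inv, norm_norm, inv_mul_cancel₀ hR0.ne']
  set v := n + (1 / 2 : ℝ) • e with hv
  have hvn : ‖v‖ ≤ 3 / 2 := by
    refine (norm_add_le _ _).trans ?_
    rw [hn1, norm_smul, Real.norm_eq_abs, abs_of_pos (by norm_num)]
    linarith
  have hin : 1 / 2 ≤ inner ℝ v n := by
    have h1 := abs_real_inner_le_norm e n
    rw [hn1, mul_one] at h1
    rw [hv, inner_add_left, real_inner_self_eq_norm_sq, hn1, real_inner_smul_left]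
    have := neg_abs_le (inner ℝ e n)
    linarith
  have hqΩ : a + (δ / 4) • v ∈ Ω := by
    refine ha ?_
    rw [mem_closedBall_iff_norm, add_sub_cancel_left, norm_smul, Real.norm_eq_abs,
      abs_of_pos (by positivity)]
    nlinarith
  obtain ⟨b, hb⟩ := hnode _ hqΩ
  refine ⟨b, ?_, hb⟩
  have hza : z - a = R • n := by rw [hn, smul_inv_smul₀ hR0.ne']
  -- The step of length at most `3δ/8` has component at least `δ/8` towards `z`; with `R ≥ δ`, at
  -- least `3δ/64` of the distance is gained. Rounding to a node loses at most `δ/64`.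
  have hq2 : ‖a + (δ / 4) • v - z‖ ^ 2 ≤ (R - 3 * δ / 64) ^ 2 := by
    have : a + (δ / 4) • v - z = (δ / 4) • v - R • n := by rw [← hza]; abel
    rw [this, norm_sub_sq_real, real_inner_smul_left, real_inner_smul_right, norm_smul, norm_smul,
      hn1, Real.norm_eq_abs, Real.norm_eq_abs, abs_of_pos hR0, abs_of_pos (by positivity)]
    have h1 : ‖v‖ ^ 2 ≤ 9 / 4 := by nlinarith [norm_nonneg v]
    have h2 : δ * R * (1 / 2) ≤ δ * R * inner ℝ v n :=
      mul_le_mul_of_nonneg_left hin (by positivity)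
    have h3 : δ ^ 2 * ‖v‖ ^ 2 ≤ δ ^ 2 * (9 / 4) := mul_le_mul_of_nonneg_left h1 (by positivity)
    have h4 : δ * δ ≤ δ * R := mul_le_mul_of_nonneg_left haz hδ.le
    nlinarith
  have hq : ‖a + (δ / 4) • v - z‖ ≤ R - 3 * δ / 64 :=
    le_of_sq_le_sq hq2 (by linarith)
  calc ‖(b : EuclideanSpace ℝ (Fin d)) - z‖
      ≤ ‖(b : EuclideanSpace ℝ (Fin d)) - (a + (δ / 4) • v)‖ + ‖a + (δ / 4) • v - z‖ :=
        norm_sub_le_norm_sub_add_norm_sub _ _ _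
    _ ≤ R - δ / 32 := by linarith

theorem gibbs_mul_exp_le (hP : P.Nonempty) {a b : P} {s : ℝ}
    (hs : β * ‖(b : EuclideanSpace ℝ (Fin d)) - z‖ ^ 2 + s ≤
      β * ‖(a : EuclideanSpace ℝ (Fin d)) - z‖ ^ 2) :
    gibbs P β z a * Real.exp s ≤ gibbs P β z b := by
  rw [gibbs, gibbs, div_mul_eq_mul_div, ← Real.exp_add]
  refine div_le_div_of_nonneg_right (Real.exp_le_exp.mpr ?_) (gibbsSum_pos hP β z).le
  linarith

theorem mul_norm_le_of_sq_inner_le {W : ℝ} (hW : W * ‖e‖ ^ 2 ≤ inner ℝ f e) :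
    W * ‖e‖ ≤ ‖f‖ := by
  by_cases he : ‖e‖ = 0
  · rw [he, mul_zero]; exact norm_nonneg f
  · have he' : 0 < ‖e‖ := lt_of_le_of_ne (norm_nonneg e) (Ne.symm he)
    have h1 := hW.trans (real_inner_le_norm f e)
    refine le_of_mul_le_mul_right ?_ he'
    linarith

/-- Weights of nodes far from `z` are exponentially small. -/
theorem gibbs_le_of_far (hP : P.Nonempty)
    (hnode : ∀ y ∈ Ω, ∃ a : P, ‖(a : EuclideanSpace ℝ (Fin d)) - y‖ ≤ h) (hβ : 0 ≤ β)
    (hδ : 0 < δ) (hhδ : h ≤ δ / 64) {a : P}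
    (ha : Metric.closedBall (a : EuclideanSpace ℝ (Fin d)) δ ⊆ Ω)
    (haz : δ ≤ ‖(a : EuclideanSpace ℝ (Fin d)) - z‖) (he : ‖e‖ ≤ 1) :
    ∃ b : P, gibbs P β z a * Real.exp (β * δ ^ 2 / 32) ≤ gibbs P β z b ∧
      ‖(b : EuclideanSpace ℝ (Fin d)) - (a + (δ / 4) •
        (‖z - a‖⁻¹ • (z - (a : EuclideanSpace ℝ (Fin d))) + (1 / 2 : ℝ) • e))‖ ≤ h := by
  obtain ⟨b, hbz, hb⟩ := exists_node_closer hnode hδ hhδ ha haz he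
  refine ⟨b, gibbs_mul_exp_le hP ?_, hb⟩
  have h1 : ‖(b : EuclideanSpace ℝ (Fin d)) - z‖ ^ 2 + δ ^ 2 / 32 ≤
      ‖(a : EuclideanSpace ℝ (Fin d)) - z‖ ^ 2 := by
    nlinarith [norm_nonneg ((b : EuclideanSpace ℝ (Fin d)) - z)]
  have := mul_le_mul_of_nonneg_left h1 hβ
  linarith

/-- `‖e‖` itself may be huge where the covariance degenerates, but `w_a ‖e‖` is not: two nodes
separated along `e`, with weights at least `w_a Λ`, make the variance at least of order `w_a Λ δ²
‖e‖²`. The square is then `w_a` times a single term of the variance `⟪f, e⟫`, hence at most `‖f‖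
(w_a ‖e‖)`. -/
theorem sq_gibbs_mul_inner_le_of_far (hP : P.Nonempty)
    (hnode : ∀ y ∈ Ω, ∃ a : P, ‖(a : EuclideanSpace ℝ (Fin d)) - y‖ ≤ h) (hβ : 0 ≤ β)
    (hδ : 0 < δ) (hhδ : h ≤ δ / 64) {a : P}
    (ha : Metric.closedBall (a : EuclideanSpace ℝ (Fin d)) δ ⊆ Ω)
    (haz : δ ≤ ‖(a : EuclideanSpace ℝ (Fin d)) - z‖)
    (hf : ∑ a, (gibbs P β z a * inner ℝ ((a : EuclideanSpace ℝ (Fin d)) - x) e) •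
      ((a : EuclideanSpace ℝ (Fin d)) - x) = f) :
    (gibbs P β z a * inner ℝ ((a : EuclideanSpace ℝ (Fin d)) - x) e) ^ 2 ≤
      128 / δ ^ 2 * ‖f‖ ^ 2 * Real.exp (-(β * δ ^ 2 / 32)) := by
  set Λ := Real.exp (β * δ ^ 2 / 32) with hΛ
  have hΛ0 : 0 < Λ := Real.exp_pos _
  set w := gibbs P β z a with hw
  have hw0 : 0 < w := gibbs_pos hP β z a
  set e' := ‖e‖⁻¹ • e with he'
  have he'1 : ‖e'‖ ≤ 1 := by
    rw [he', norm_smul, norm_inv, norm_norm]; exact inv_mul_le_one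
  obtain ⟨b, hb, hbq⟩ := gibbs_le_of_far hP hnode hβ hδ hhδ ha haz he'1
  obtain ⟨b', hb', hbq'⟩ := gibbs_le_of_far hP hnode hβ hδ hhδ ha haz
    (e := -e') (by rwa [norm_neg])
  have hV := mul_sq_inner_sub_le (x := x) (e := e) hP (mul_pos hw0 hΛ0).le hb hb'
  rw [sum_gibbs_mul_sq_inner hf] at hV
  have hsep : δ / 8 * ‖e‖ ≤ inner ℝ ((b : EuclideanSpace ℝ (Fin d)) - b') e := by
    set q := (a : EuclideanSpace ℝ (Fin d)) + (δ / 4) •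
        (‖z - a‖⁻¹ • (z - (a : EuclideanSpace ℝ (Fin d))) + (1 / 2 : ℝ) • e') with hq
    set q' := (a : EuclideanSpace ℝ (Fin d)) + (δ / 4) •
        (‖z - a‖⁻¹ • (z - (a : EuclideanSpace ℝ (Fin d))) + (1 / 2 : ℝ) • -e') with hq'
    have hdec : (b : EuclideanSpace ℝ (Fin d)) - b' =
        (δ / 4) • e' + ((b - q) - (b' - q')) := by
      have : q - q' = (δ / 4) • e' := by rw [hq, hq']; module
      rw [← this]; abel
    have h1 : inner ℝ e' e = ‖e‖ := by
      rw [he', real_inner_smul_left, real_inner_self_eq_norm_sq]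
      by_cases h0 : ‖e‖ = 0
      · simp [h0]
      · field_simp
    have h2 := neg_abs_le (inner ℝ ((b - q) - (b' - q')) e)
    have h3 := abs_real_inner_le_norm ((b - q) - (b' - q')) e
    have h4 : ‖((b : EuclideanSpace ℝ (Fin d)) - q) - (b' - q')‖ ≤ 2 * h :=
      (norm_sub_le _ _).trans (by linarith)
    have h5 := mul_le_mul_of_nonneg_right h4 (norm_nonneg e)
    have h6 := mul_le_mul_of_nonneg_right hhδ (norm_nonneg e)
    rw [hdec, inner_add_left, real_inner_smul_left, h1]
    nlinarith [mul_nonneg hδ.le (norm_nonneg e)]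
  have hsep2 : (δ / 8 * ‖e‖) ^ 2 ≤ inner ℝ ((b : EuclideanSpace ℝ (Fin d)) - b') e ^ 2 :=
    pow_le_pow_left₀ (by positivity) hsep 2
  have hκ : (w * Λ * δ ^ 2 / 128) * ‖e‖ ^ 2 ≤ inner ℝ f e := by
    have := mul_le_mul_of_nonneg_left hsep2 (mul_pos hw0 hΛ0).le
    nlinarith
  have hwe := mul_norm_le_of_sq_inner_le hκ
  have hsingle : w * inner ℝ ((a : EuclideanSpace ℝ (Fin d)) - x) e ^ 2 ≤ inner ℝ f e := by
    rw [← sum_gibbs_mul_sq_inner hf]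
    exact Finset.single_le_sum (f := fun a : P => gibbs P β z a *
      inner ℝ ((a : EuclideanSpace ℝ (Fin d)) - x) e ^ 2)
      (fun b _ => mul_nonneg (gibbs_pos hP β z b).le (sq_nonneg _)) (Finset.mem_univ a)
  have h1 : w * inner ℝ ((a : EuclideanSpace ℝ (Fin d)) - x) e ^ 2 ≤ ‖f‖ * ‖e‖ :=
    hsingle.trans (real_inner_le_norm f e)
  have h2 : w * ‖e‖ ≤ 128 / δ ^ 2 * ‖f‖ * Λ⁻¹ := by
    have : w * ‖e‖ = (w * Λ * δ ^ 2 / 128 * ‖e‖) * (128 / δ ^ 2 * Λ⁻¹) := by field_simp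
    rw [this]
    calc _ ≤ ‖f‖ * (128 / δ ^ 2 * Λ⁻¹) := mul_le_mul_of_nonneg_right hwe (by positivity)
      _ = _ := by ring
  rw [Real.exp_neg, ← hΛ]
  calc (w * inner ℝ ((a : EuclideanSpace ℝ (Fin d)) - x) e) ^ 2
      = w * (w * inner ℝ ((a : EuclideanSpace ℝ (Fin d)) - x) e ^ 2) := by ring
    _ ≤ w * (‖f‖ * ‖e‖) := mul_le_mul_of_nonneg_left h1 hw0.le
    _ = ‖f‖ * (w * ‖e‖) := by ring
    _ ≤ ‖f‖ * (128 / δ ^ 2 * ‖f‖ * Λ⁻¹) := mul_le_mul_of_nonneg_left h2 (norm_nonneg f)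
    _ = _ := by ring

/-- The centre `z` of the weights at `x` can be far from `x` only if the nodes are coarse. -/
theorem le_of_le_norm_sub_gibbsMean (hP : P.Nonempty)
    (hnode : ∀ y ∈ Ω, ∃ a : P, ‖(a : EuclideanSpace ℝ (Fin d)) - y‖ ≤ h) (hβ : 0 ≤ β)
    (hδ : 0 < δ) (hhδ : h ≤ δ / 4) (hxΩ : Metric.closedBall x δ ⊆ Ω) {D : ℝ}
    (hD : ∀ a : P, ‖(a : EuclideanSpace ℝ (Fin d)) - x‖ ≤ D)
    (hz : gibbsMean P β z = x) (hxz : δ ≤ ‖z - x‖) :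
    δ / 4 ≤ P.card * D * Real.exp (-(β * δ ^ 2 / 16)) := by
  set R := ‖z - x‖ with hR
  have hR0 : 0 < R := hδ.trans_le hxz
  set n := R⁻¹ • (z - x) with hn
  have hn1 : ‖n‖ = 1 := by rw [hn, norm_smul, norm_inv, norm_norm, inv_mul_cancel₀ hR0.ne']
  have hzx : z - x = R • n := by rw [hn, smul_inv_smul₀ hR0.ne']
  have hqΩ : x + (δ / 2) • n ∈ Ω := by
    refine hxΩ ?_
    rw [mem_closedBall_iff_norm, add_sub_cancel_left, norm_smul, hn1, Real.norm_eq_abs,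
      abs_of_pos (by positivity)]
    linarith
  obtain ⟨b, hb⟩ := hnode _ hqΩ
  have hbz : ‖(b : EuclideanSpace ℝ (Fin d)) - z‖ ≤ R - δ / 4 := by
    have h1 : (b : EuclideanSpace ℝ (Fin d)) - z = (b - (x + (δ / 2) • n)) - (R - δ / 2) • n := by
      rw [sub_smul, ← hzx]; abel
    rw [h1]
    refine (norm_sub_le _ _).trans ?_
    rw [norm_smul, hn1, Real.norm_eq_abs, abs_of_nonneg (by linarith)]
    linarith
  have hbn : δ / 4 ≤ inner ℝ ((b : EuclideanSpace ℝ (Fin d)) - x) n := by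
    have h1 : (b : EuclideanSpace ℝ (Fin d)) - x = (δ / 2) • n + (b - (x + (δ / 2) • n)) := by
      abel
    have h2 := neg_abs_le (inner ℝ ((b : EuclideanSpace ℝ (Fin d)) - (x + (δ / 2) • n)) n)
    have h3 := abs_real_inner_le_norm ((b : EuclideanSpace ℝ (Fin d)) - (x + (δ / 2) • n)) n
    rw [hn1, mul_one] at h3
    rw [h1, inner_add_left, real_inner_smul_left, real_inner_self_eq_norm_sq, hn1]
    linarith
  have hD0 : 0 ≤ D := (norm_nonneg _).trans (hD b)
  set X := Real.exp (-(β * δ ^ 2 / 16)) with hX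
  have hX0 : 0 < X := Real.exp_pos _
  set w := gibbs P β z b with hw
  have hw0 : 0 < w := gibbs_pos hP β z b
  -- The first moments along `n` sum to zero. A node with negative moment lies at distance at least
  -- `R` from `z`, while `b` lies within `R - δ/4`, so its weight is at most `w X`. Adding `w X D`
  -- makes all terms nonnegative, and the sum then dominates the term of `b`.
  have hterm : ∀ a : P, 0 ≤ gibbs P β z a * inner ℝ ((a : EuclideanSpace ℝ (Fin d)) - x) n +
      w * X * D := fun a => by
    have ha0 := gibbs_pos hP β z a
    by_cases hneg : 0 ≤ inner ℝ ((a : EuclideanSpace ℝ (Fin d)) - x) n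
    · positivity
    · push Not at hneg
      have hfar : R ≤ ‖(a : EuclideanSpace ℝ (Fin d)) - z‖ := by
        have h1 := real_inner_le_norm (z - (a : EuclideanSpace ℝ (Fin d))) n
        rw [hn1, mul_one, norm_sub_rev] at h1
        have h2 : z - (a : EuclideanSpace ℝ (Fin d)) = R • n - (a - x) := by rw [← hzx]; abel
        rw [h2, inner_sub_left, real_inner_smul_left, real_inner_self_eq_norm_sq, hn1] at h1
        linarith
      have hwa : gibbs P β z a * Real.exp (β * δ ^ 2 / 16) ≤ w := by
        refine gibbs_mul_exp_le hP ?_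
        have h1 : ‖(b : EuclideanSpace ℝ (Fin d)) - z‖ ^ 2 + δ ^ 2 / 16 ≤
            ‖(a : EuclideanSpace ℝ (Fin d)) - z‖ ^ 2 := by
          nlinarith [norm_nonneg ((b : EuclideanSpace ℝ (Fin d)) - z)]
        have := mul_le_mul_of_nonneg_left h1 hβ
        linarith
      have hwa' : gibbs P β z a ≤ w * X := by
        rw [hX, Real.exp_neg, ← div_eq_mul_inv, le_div_iff₀ (Real.exp_pos _)]
        exact hwa
      have h3 := abs_real_inner_le_norm ((a : EuclideanSpace ℝ (Fin d)) - x) n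
      rw [hn1, mul_one] at h3
      have h4 := (neg_abs_le (inner ℝ ((a : EuclideanSpace ℝ (Fin d)) - x) n))
      have h5 := hD a
      have h6 : gibbs P β z a * D ≤ w * X * D := mul_le_mul_of_nonneg_right hwa' hD0
      nlinarith
  have hsum := Finset.single_le_sum (fun a _ => hterm a) (Finset.mem_univ b)
  rw [Finset.sum_add_distrib, sum_gibbs_inner_sub hP hz n, zero_add, Finset.sum_const,
    Finset.card_univ, Fintype.card_coe, nsmul_eq_mul] at hsum
  have h1 : w * (δ / 4) ≤ w * inner ℝ ((b : EuclideanSpace ℝ (Fin d)) - x) n :=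
    mul_le_mul_of_nonneg_left hbn hw0.le
  have h2 : 0 ≤ w * X * D := by positivity
  refine le_of_mul_le_mul_left ?_ hw0
  calc w * (δ / 4) ≤ P.card * (w * X * D) := by linarith
    _ = w * (P.card * D * X) := by ring

end WeightEstimates

/-! ### Moments and covariance when the centre is well inside `Ω`. -/

section NearEstimates

variable {d : ℕ}

theorem exists_pow_three_le_exp {γ : ℝ} (hγ : 0 < γ) (A : ℝ) (hA : 0 ≤ A) :
    ∃ C : ℝ, 0 < C ∧ ∀ r : ℝ, 0 ≤ r → (r + A) ^ 3 ≤ C * Real.exp (γ / 2 * r ^ 2) := by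
  refine ⟨6 * Real.exp (1 / (2 * γ) + A), by positivity, fun r hr => ?_⟩
  have h1 := Real.pow_div_factorial_le_exp (r + A) (by positivity) 3
  have h2 : r + A ≤ (1 / (2 * γ) + A) + γ / 2 * r ^ 2 := by
    have : 0 ≤ γ / 2 * (r - 1 / γ) ^ 2 := by positivity
    have e : γ / 2 * (r - 1 / γ) ^ 2 = γ / 2 * r ^ 2 - r + 1 / (2 * γ) := by field_simp; ring
    linarith
  have h3 := Real.exp_le_exp.mpr h2
  have h4 : ((Nat.factorial 3 : ℕ) : ℝ) = 6 := by norm_num [Nat.factorial]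
  rw [h4, div_le_iff₀ (by norm_num)] at h1
  rw [Real.exp_add (1 / (2 * γ) + A)] at h3
  linarith

/-- Moment and covariance bounds for Gaussian weights whose centre is well inside `Ω`. -/
theorem exists_gibbs_moment_bounds (d : ℕ) {γ τ : ℝ} (hγ : 0 < γ) (hτ : 0 < τ) :
    ∃ C : ℝ, 0 < C ∧ ∀ (P : Finset (EuclideanSpace ℝ (Fin d))) (h : ℝ)
      (Ω : Set (EuclideanSpace ℝ (Fin d))), P.Nonempty → 0 < h → HasHDensityLE P h τ →
      (∀ y ∈ Ω, ∃ a : P, ‖(a : EuclideanSpace ℝ (Fin d)) - y‖ ≤ h) →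
      ∀ x z : EuclideanSpace ℝ (Fin d), Metric.closedBall z (2 * h) ⊆ Ω →
      gibbsMean P (γ / h ^ 2) z = x →
      ∑ a, gibbs P (γ / h ^ 2) z a * ‖(a : EuclideanSpace ℝ (Fin d)) - x‖ ≤ C * h ∧
      ∑ a, gibbs P (γ / h ^ 2) z a * ‖(a : EuclideanSpace ℝ (Fin d)) - x‖ ^ 3 ≤ C * h ^ 3 ∧
      ∀ e f : EuclideanSpace ℝ (Fin d),
        ∑ a, (gibbs P (γ / h ^ 2) z a * inner ℝ ((a : EuclideanSpace ℝ (Fin d)) - x) e) •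
          ((a : EuclideanSpace ℝ (Fin d)) - x) = f → h ^ 2 * ‖e‖ ≤ C * ‖f‖ := by
  obtain ⟨S, hS0, hS⟩ := exists_sum_exp_le d hγ hτ
  obtain ⟨K₁, hK₁, hK₁'⟩ := exists_pow_three_le_exp hγ 1 zero_le_one
  set A := Real.exp γ * K₁ * S with hA
  have hA0 : 0 < A := by positivity
  obtain ⟨K₂, hK₂, hK₂'⟩ := exists_pow_three_le_exp hγ (A + 1) (by positivity)
  refine ⟨max (Real.exp γ * K₂ * S) (Real.exp (9 * γ) * S), by positivity, ?_⟩
  intro P h Ω hP hh hdens hnode x z hzΩ hzx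
  set r : P → ℝ := fun a => ‖(a : EuclideanSpace ℝ (Fin d)) - z‖ / h with hr
  have hr0 : ∀ a, 0 ≤ r a := fun a => by positivity
  have hrh : ∀ a : P, ‖(a : EuclideanSpace ℝ (Fin d)) - z‖ = h * r a := fun a => by
    rw [hr]; field_simp
  set w := gibbs P (γ / h ^ 2) z with hw
  have hexp : ∀ a : P, -(γ / h ^ 2) * ‖(a : EuclideanSpace ℝ (Fin d)) - z‖ ^ 2 =
      -γ * r a ^ 2 := fun a => by rw [hrh]; field_simp
  have hw0 : ∀ a, 0 ≤ w a := fun a => (gibbs_pos hP _ z a).le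
  have hZlow : Real.exp (-γ) ≤ gibbsSum P (γ / h ^ 2) z := by
    obtain ⟨a, ha⟩ := hnode z (hzΩ (Metric.mem_closedBall_self (by positivity)))
    refine le_trans ?_ (Finset.single_le_sum (fun b _ => (Real.exp_pos _).le) (Finset.mem_univ a))
    rw [hexp]
    have h1 : r a ≤ 1 := by rw [hr]; exact (div_le_one hh).mpr ha
    have h2 := hr0 a
    have h3 : r a ^ 2 ≤ 1 := pow_le_one₀ h2 h1
    exact Real.exp_le_exp.mpr (by nlinarith)
  have hZup : gibbsSum P (γ / h ^ 2) z ≤ S := by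
    refine le_trans (Finset.sum_le_sum fun a _ => Real.exp_le_exp.mpr ?_) (hS P h hh hdens z)
    rw [hexp]
    nlinarith [sq_nonneg (r a)]
  have hZ0 := gibbsSum_pos hP (γ / h ^ 2) z
  have hwup : ∀ a, w a ≤ Real.exp γ * Real.exp (-γ * r a ^ 2) := fun a => by
    rw [hw, gibbs, hexp, div_le_iff₀ hZ0]
    have h1 : 1 ≤ Real.exp γ * gibbsSum P (γ / h ^ 2) z := by
      have := mul_le_mul_of_nonneg_left hZlow (Real.exp_pos γ).le
      rwa [← Real.exp_add, add_neg_cancel, Real.exp_zero] at this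
    have := mul_le_mul_of_nonneg_right h1 (Real.exp_pos (-γ * r a ^ 2)).le
    linarith
  -- One half of the Gaussian exponent absorbs the cubic factor; the other half is summed over the
  -- nodes by `hS`.
  have hmom : ∀ (B K : ℝ), 0 < K → (∀ s : ℝ, 0 ≤ s → (s + B) ^ 3 ≤ K * Real.exp (γ / 2 * s ^ 2)) →
      ∑ a, w a * (r a + B) ^ 3 ≤ Real.exp γ * K * S := fun B K hK hBK => by
    calc ∑ a, w a * (r a + B) ^ 3
        ≤ ∑ a, Real.exp γ * K * Real.exp (-(γ / 2) * r a ^ 2) := by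
          refine Finset.sum_le_sum fun a _ => ?_
          calc w a * (r a + B) ^ 3 ≤ w a * (K * Real.exp (γ / 2 * r a ^ 2)) :=
                mul_le_mul_of_nonneg_left (hBK _ (hr0 a)) (hw0 a)
            _ ≤ (Real.exp γ * Real.exp (-γ * r a ^ 2)) * (K * Real.exp (γ / 2 * r a ^ 2)) :=
                mul_le_mul_of_nonneg_right (hwup a) (by positivity)
            _ = Real.exp γ * K * (Real.exp (-γ * r a ^ 2) * Real.exp (γ / 2 * r a ^ 2)) := by ring
            _ = _ := by rw [← Real.exp_add]; congr 2; ring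
      _ = Real.exp γ * K * ∑ a, Real.exp (-(γ / 2) * r a ^ 2) := (Finset.mul_sum _ _ _).symm
      _ ≤ _ := mul_le_mul_of_nonneg_left (hS P h hh hdens z) (by positivity)
  have hm1 := hmom 1 K₁ hK₁ hK₁'
  have hm2 := hmom (A + 1) K₂ hK₂ hK₂'
  -- As `x` is the barycentre, its distance to `z` is at most the first moment about `z`; moments
  -- about `x` then follow from moments about `z`.
  have hxz : ‖z - x‖ ≤ h * A := by
    have h1 : x - z = ∑ a, w a • ((a : EuclideanSpace ℝ (Fin d)) - z) := by
      simp only [smul_sub, Finset.sum_sub_distrib, ← Finset.sum_smul]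
      rw [sum_gibbs hP, one_smul, ← hzx, gibbsMean]
    rw [norm_sub_rev, h1]
    refine (norm_sum_le _ _).trans ?_
    calc ∑ a, ‖w a • ((a : EuclideanSpace ℝ (Fin d)) - z)‖ = ∑ a, h * (w a * r a) :=
          Finset.sum_congr rfl fun a _ => by
            rw [norm_smul, Real.norm_eq_abs, abs_of_nonneg (hw0 a), hrh]; ring
      _ = h * ∑ a, w a * r a := (Finset.mul_sum _ _ _).symm
      _ ≤ h * ∑ a, w a * (r a + 1) ^ 3 := by
          refine mul_le_mul_of_nonneg_left (Finset.sum_le_sum fun a _ => ?_) hh.le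
          refine mul_le_mul_of_nonneg_left ?_ (hw0 a)
          have h1 : r a + 1 ≤ (r a + 1) ^ 3 := le_self_pow₀ (by linarith [hr0 a]) (by norm_num)
          linarith
      _ ≤ h * A := mul_le_mul_of_nonneg_left hm1 hh.le
  have hax : ∀ a : P, ‖(a : EuclideanSpace ℝ (Fin d)) - x‖ ≤ h * (r a + (A + 1)) := fun a => by
    calc ‖(a : EuclideanSpace ℝ (Fin d)) - x‖ ≤ ‖(a : EuclideanSpace ℝ (Fin d)) - z‖ + ‖z - x‖ :=
          norm_sub_le_norm_sub_add_norm_sub _ _ _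
      _ ≤ _ := by rw [hrh]; nlinarith
  refine ⟨?_, ?_, ?_⟩
  · calc ∑ a, w a * ‖(a : EuclideanSpace ℝ (Fin d)) - x‖
        ≤ ∑ a, h * (w a * (r a + (A + 1)) ^ 3) := by
          refine Finset.sum_le_sum fun a _ => ?_
          have h1 : r a + (A + 1) ≤ (r a + (A + 1)) ^ 3 :=
            le_self_pow₀ (by linarith [hr0 a]) (by norm_num)
          calc w a * ‖(a : EuclideanSpace ℝ (Fin d)) - x‖ ≤ w a * (h * (r a + (A + 1)) ^ 3) :=
                mul_le_mul_of_nonneg_left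
                  ((hax a).trans (mul_le_mul_of_nonneg_left h1 hh.le)) (hw0 a)
            _ = _ := by ring
      _ = h * ∑ a, w a * (r a + (A + 1)) ^ 3 := (Finset.mul_sum _ _ _).symm
      _ ≤ h * (Real.exp γ * K₂ * S) := mul_le_mul_of_nonneg_left hm2 hh.le
      _ ≤ _ := by rw [mul_comm]; exact mul_le_mul_of_nonneg_right (le_max_left _ _) hh.le
  · calc ∑ a, w a * ‖(a : EuclideanSpace ℝ (Fin d)) - x‖ ^ 3
        ≤ ∑ a, h ^ 3 * (w a * (r a + (A + 1)) ^ 3) := by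
          refine Finset.sum_le_sum fun a _ => ?_
          calc w a * ‖(a : EuclideanSpace ℝ (Fin d)) - x‖ ^ 3
                ≤ w a * (h * (r a + (A + 1))) ^ 3 :=
                mul_le_mul_of_nonneg_left
                  (pow_le_pow_left₀ (norm_nonneg _) (hax a) 3) (hw0 a)
            _ = _ := by ring
      _ = h ^ 3 * ∑ a, w a * (r a + (A + 1)) ^ 3 := (Finset.mul_sum _ _ _).symm
      _ ≤ h ^ 3 * (Real.exp γ * K₂ * S) := mul_le_mul_of_nonneg_left hm2 (by positivity)
      _ ≤ _ := by rw [mul_comm]; exact mul_le_mul_of_nonneg_right (le_max_left _ _) (by positivity)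
  · intro e f hf
    set e' := ‖e‖⁻¹ • e with he'
    have he'1 : ‖e'‖ ≤ 1 := by
      rw [he', norm_smul, norm_inv, norm_norm]; exact inv_mul_le_one
    have hmem : ∀ u : EuclideanSpace ℝ (Fin d), ‖u‖ ≤ 1 → z + (2 * h) • u ∈ Ω := fun u hu => by
      refine hzΩ ?_
      rw [mem_closedBall_iff_norm, add_sub_cancel_left, norm_smul, Real.norm_eq_abs,
        abs_of_pos (by positivity)]
      nlinarith
    have hlow : ∀ (b : P) (u : EuclideanSpace ℝ (Fin d)), ‖u‖ ≤ 1 →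
        ‖(b : EuclideanSpace ℝ (Fin d)) - (z + (2 * h) • u)‖ ≤ h →
        Real.exp (-(9 * γ)) / S ≤ w b := fun b u hu hb => by
      have h1 : ‖(b : EuclideanSpace ℝ (Fin d)) - z‖ ≤ 3 * h := by
        have : (b : EuclideanSpace ℝ (Fin d)) - z = (b - (z + (2 * h) • u)) + (2 * h) • u := by abel
        rw [this]
        refine (norm_add_le _ _).trans ?_
        rw [norm_smul, Real.norm_eq_abs, abs_of_pos (by positivity)]
        nlinarith
      have h2 : r b ≤ 3 := by rw [hr]; exact (div_le_iff₀ hh).mpr h1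
      rw [hw, gibbs, hexp]
      refine div_le_div₀ (Real.exp_pos _).le (Real.exp_le_exp.mpr ?_) hZ0 hZup
      have h3 : r b ^ 2 ≤ 9 := by nlinarith [hr0 b]
      nlinarith
    obtain ⟨b, hb⟩ := hnode _ (hmem e' he'1)
    obtain ⟨b', hb'⟩ := hnode _ (hmem (-e') (by rwa [norm_neg]))
    have hW0 : 0 < Real.exp (-(9 * γ)) / S := by positivity
    have hV := mul_sq_inner_sub_le (x := x) (e := e) hP hW0.le (hlow b e' he'1 hb)
      (hlow b' (-e') (by rwa [norm_neg]) hb')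
    rw [sum_gibbs_mul_sq_inner hf] at hV
    -- The targets `z ± 2h e'` are `4h` apart along `e`, and rounding to nodes loses at most `2h`.
    have hsep : 2 * h * ‖e‖ ≤ inner ℝ ((b : EuclideanSpace ℝ (Fin d)) - b') e := by
      set q := z + (2 * h) • e' with hq
      set q' := z + (2 * h) • -e' with hq'
      have hdec : (b : EuclideanSpace ℝ (Fin d)) - b' =
          (4 * h) • e' + ((b - q) - (b' - q')) := by
        have : q - q' = (4 * h) • e' := by rw [hq, hq']; module
        rw [← this]; abel
      have h1 : inner ℝ e' e = ‖e‖ := by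
        rw [he', real_inner_smul_left, real_inner_self_eq_norm_sq]
        by_cases h0 : ‖e‖ = 0
        · simp [h0]
        · field_simp
      have h2 := neg_abs_le (inner ℝ ((b - q) - (b' - q')) e)
      have h3 := abs_real_inner_le_norm ((b - q) - (b' - q')) e
      have h4 : ‖((b : EuclideanSpace ℝ (Fin d)) - q) - (b' - q')‖ ≤ 2 * h :=
        (norm_sub_le _ _).trans (by linarith)
      have h5 := mul_le_mul_of_nonneg_right h4 (norm_nonneg e)
      rw [hdec, inner_add_left, real_inner_smul_left, h1]
      linarith
    have hsep2 : (2 * h * ‖e‖) ^ 2 ≤ inner ℝ ((b : EuclideanSpace ℝ (Fin d)) - b') e ^ 2 :=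
      pow_le_pow_left₀ (by positivity) hsep 2
    have hκ : (Real.exp (-(9 * γ)) / S * h ^ 2) * ‖e‖ ^ 2 ≤ inner ℝ f e := by
      have h1 := mul_le_mul_of_nonneg_left hsep2 hW0.le
      have h2 : 0 ≤ Real.exp (-(9 * γ)) / S * (h ^ 2 * ‖e‖ ^ 2) := by positivity
      nlinarith
    have he := mul_norm_le_of_sq_inner_le hκ
    have h1 : h ^ 2 * ‖e‖ ≤ Real.exp (9 * γ) * S * ‖f‖ := by
      have : h ^ 2 * ‖e‖ = Real.exp (9 * γ) * S * (Real.exp (-(9 * γ)) / S * h ^ 2 * ‖e‖) := by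
        rw [Real.exp_neg]; field_simp
      rw [this]
      exact mul_le_mul_of_nonneg_left he (by positivity)
    exact h1.trans (mul_le_mul_of_nonneg_right (le_max_right _ _) (norm_nonneg f))

theorem exists_forall_div_pow_mul_exp_le (d : ℕ) {C c η : ℝ} (hc : 0 < c) (hη : 0 < η) :
    ∃ h₀ : ℝ, 0 < h₀ ∧ ∀ h : ℝ, 0 < h → h < h₀ → C / h ^ d * Real.exp (-(c / h ^ 2)) ≤ η := by
  have h1 : Tendsto (fun h : ℝ => (h ^ 2)⁻¹) (𝓝[>] 0) atTop := by
    refine tendsto_inv_nhdsGT_zero.comp ?_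
    refine tendsto_nhdsWithin_iff.mpr ⟨?_, ?_⟩
    · have : Tendsto (fun h : ℝ => h ^ 2) (𝓝 0) (𝓝 (0 ^ 2)) := (continuous_pow 2).tendsto 0
      rw [zero_pow two_ne_zero] at this
      exact this.mono_left nhdsWithin_le_nhds
    · filter_upwards [self_mem_nhdsWithin] with h hh
      exact pow_pos (Set.mem_Ioi.mp hh) 2
  have h2 := ((tendsto_rpow_mul_exp_neg_mul_atTop_nhds_zero (d / 2 : ℝ) c hc).comp h1).const_mul C
  rw [mul_zero] at h2
  have h3 := h2.eventually (Iio_mem_nhds hη)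
  obtain ⟨h₀, hh₀, hsub⟩ := mem_nhdsGT_iff_exists_Ioo_subset.mp h3
  refine ⟨h₀, hh₀, fun h hh hlt => ?_⟩
  have h4 : C * (((h ^ 2)⁻¹) ^ (d / 2 : ℝ) * Real.exp (-c * (h ^ 2)⁻¹)) < η := hsub ⟨hh, hlt⟩
  have h5 : ((h ^ 2)⁻¹) ^ (d / 2 : ℝ) = (h ^ d)⁻¹ := by
    rw [Real.inv_rpow (by positivity), ← Real.rpow_natCast h 2, ← Real.rpow_mul hh.le,
      ← Real.rpow_natCast h d]
    congr 2
    push_cast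
    ring
  rw [h5] at h4
  calc C / h ^ d * Real.exp (-(c / h ^ 2)) = C * ((h ^ d)⁻¹ * Real.exp (-c * (h ^ 2)⁻¹)) := by
        rw [div_eq_mul_inv, mul_assoc, neg_mul, div_eq_mul_inv]
    _ ≤ η := h4.le

end NearEstimates

/-! ### Uniform approximation of test functions and their gradients. -/

section UniformApproximation

variable {d : ℕ} {Ω : Set (EuclideanSpace ℝ (Fin d))} {φ : EuclideanSpace ℝ (Fin d) → ℝ}

theorem norm_le_of_interior_convexHull_subset {P : Finset (EuclideanSpace ℝ (Fin d))} {R : ℝ}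
    (hne : (interior (convexHull ℝ (P : Set (EuclideanSpace ℝ (Fin d))))).Nonempty)
    (hR : interior (convexHull ℝ (P : Set (EuclideanSpace ℝ (Fin d)))) ⊆
      Metric.closedBall 0 R) : ∀ a ∈ P, ‖a‖ ≤ R := fun a ha => by
  have h1 : a ∈ closure (interior (convexHull ℝ (P : Set (EuclideanSpace ℝ (Fin d))))) := by
    rw [(convex_convexHull ℝ _).closure_interior_eq_closure_of_nonempty_interior hne]
    exact subset_closure (subset_convexHull ℝ _ ha)
  have h2 := closure_minimal hR Metric.isClosed_closedBall h1
  simpa using h2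

theorem exists_taylor_bounds (hφ : ContDiff ℝ ∞ φ) (hc : HasCompactSupport φ) :
    ∃ L : ℝ, 0 < L ∧ ∀ x y : EuclideanSpace ℝ (Fin d), |φ x| ≤ L ∧
      |φ y - φ x| ≤ L * ‖y - x‖ ∧ |φ y - φ x - fderiv ℝ φ x (y - x)| ≤ L * ‖y - x‖ ^ 2 := by
  obtain ⟨L₀, h0⟩ := hφ.continuous.bounded_above_of_compact_support hc
  obtain ⟨L₁, h1⟩ := ContDiff.lipschitzWith_of_hasCompactSupport hc hφ (by simp)
  obtain ⟨L₂, h2⟩ := ContDiff.lipschitzWith_of_hasCompactSupport (hc.fderiv ℝ)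
    (hφ.fderiv_right (m := 1) (by norm_cast)) one_ne_zero
  have hL : ∀ t : ℝ, 0 ≤ t → L₀ * t ≤ (|L₀| + L₁ + L₂ + 1) * t ∧
      L₁ * t ≤ (|L₀| + L₁ + L₂ + 1) * t ∧ L₂ * t ≤ (|L₀| + L₁ + L₂ + 1) * t := fun t ht => by
    have := le_abs_self L₀
    have := abs_nonneg L₀
    refine ⟨?_, ?_, ?_⟩ <;> refine mul_le_mul_of_nonneg_right ?_ ht <;>
      linarith [L₁.coe_nonneg, L₂.coe_nonneg]
  refine ⟨|L₀| + L₁ + L₂ + 1, by positivity, fun x y => ⟨?_, ?_, ?_⟩⟩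
  · have := (hL 1 zero_le_one).1
    have h3 := h0 x
    rw [Real.norm_eq_abs] at h3
    linarith
  · have h3 := h1.norm_sub_le y x
    rw [Real.norm_eq_abs] at h3
    exact h3.trans (hL _ (norm_nonneg _)).2.1
  · have hderiv : ∀ y' ∈ Metric.closedBall x ‖y - x‖, HasFDerivWithinAt
        (fun y' => φ y' - fderiv ℝ φ x y') (fderiv ℝ φ y' - fderiv ℝ φ x)
        (Metric.closedBall x ‖y - x‖) y' := fun y' _ =>
      ((hφ.differentiable (by simp) y').hasFDerivAt.sub
        (fderiv ℝ φ x).hasFDerivAt).hasFDerivWithinAt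
    have hbound : ∀ y' ∈ Metric.closedBall x ‖y - x‖,
        ‖fderiv ℝ φ y' - fderiv ℝ φ x‖ ≤ L₂ * ‖y - x‖ := fun y' hy' =>
      (h2.norm_sub_le y' x).trans
        (mul_le_mul_of_nonneg_left (mem_closedBall_iff_norm.mp hy') L₂.coe_nonneg)
    have h3 := Convex.norm_image_sub_le_of_norm_hasFDerivWithin_le hderiv hbound
      (convex_closedBall x _) (Metric.mem_closedBall_self (norm_nonneg _))
      (mem_closedBall_iff_norm.mpr le_rfl)
    rw [Real.norm_eq_abs] at h3
    have h4 : φ y - φ x - fderiv ℝ φ x (y - x) =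
        φ y - fderiv ℝ φ x y - (φ x - fderiv ℝ φ x x) := by rw [map_sub]; ring
    rw [h4, pow_two, ← mul_assoc]
    rw [mul_assoc] at h3 ⊢
    exact h3.trans (hL _ (by positivity)).2.2

/-- The LME interpolants of a test function converge uniformly with their gradients. -/
theorem exists_uniform_approx (hΩo : IsOpen Ω) (hΩb : Bornology.IsBounded Ω)
    (hφ : IsTestFunction Ω φ) {γ τ ε : ℝ} (hγ : 0 < γ) (hτ : 0 < τ) (hε : 0 < ε) :
    ∃ h₀ : ℝ, 0 < h₀ ∧ ∀ (P : Finset (EuclideanSpace ℝ (Fin d))) (h : ℝ), 0 < h → h < h₀ →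
      interior (convexHull ℝ (P : Set (EuclideanSpace ℝ (Fin d)))) = Ω →
      IsHCovering (P : Set (EuclideanSpace ℝ (Fin d))) h Ω → HasHDensityLE P h τ → ∀ x ∈ Ω,
      |∑ a : P, φ a * lmeShape P (γ / h ^ 2) x a - φ x| ≤ ε ∧
      ∀ f, |fderiv ℝ (fun y => ∑ a : P, φ a * lmeShape P (γ / h ^ 2) y a) x f -
        fderiv ℝ φ x f| ≤ ε * ‖f‖ := by
  obtain ⟨L, hL0, hL⟩ := exists_taylor_bounds hφ.smooth hφ.hasCompactSupport
  obtain ⟨δ', hδ', hthick⟩ :=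
    hφ.hasCompactSupport.isCompact.exists_cthickening_subset_open hΩo hφ.tsupport_subset
  set δ := δ' / 2 with hδ
  have hδ0 : 0 < δ := by positivity
  have hball : ∀ y ∈ tsupport φ, Metric.closedBall y (2 * δ) ⊆ Ω := fun y hy => by
    rw [hδ, mul_div_cancel₀ _ two_ne_zero]
    exact (Metric.closedBall_subset_cthickening hy δ').trans hthick
  obtain ⟨R, hR0, hR⟩ := hΩb.subset_closedBall_lt 0 0
  obtain ⟨C₁, hC₁, hcard⟩ := exists_card_le d hτ R
  obtain ⟨C₂, hC₂, hmom⟩ := exists_gibbs_moment_bounds d hγ hτ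
  -- `η` bounds the number of nodes times the exponential factor. The three entries serve, in turn,
  -- the values, the gradients, and the contradiction that excludes `x` from the support.
  set η := min (min (ε / L) (ε * δ / (12 * L))) (δ / (16 * R)) with hη
  have hη0 : 0 < η := by positivity
  have hη1 : L * η ≤ ε := by
    have : η ≤ ε / L := (min_le_left _ _).trans (min_le_left _ _)
    rw [le_div_iff₀ hL0] at this
    linarith
  have hη2 : L * (12 / δ) * η ≤ ε := by
    have : η ≤ ε * δ / (12 * L) := (min_le_left _ _).trans (min_le_right _ _)
    rw [le_div_iff₀ (by positivity)] at this
    rw [mul_div_assoc', div_mul_eq_mul_div, div_le_iff₀ hδ0]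
    linarith
  have hη3 : 2 * R * η ≤ δ / 8 := by
    have : η ≤ δ / (16 * R) := min_le_right _ _
    rw [le_div_iff₀ (by positivity)] at this
    linarith
  -- The constant `64` is twice the `32` in the weight estimates: the gradient estimate bounds a
  -- square, so its root halves the exponent.
  obtain ⟨h₁, hh₁, hsmall⟩ := exists_forall_div_pow_mul_exp_le d (C := C₁)
    (c := γ * δ ^ 2 / 64) (by positivity) hη0
  refine ⟨min (min h₁ 1) (min (δ / 64) (min (ε / (L * C₂)) (ε / (L * C₂ * C₂)))),
    by positivity, ?_⟩
  intro P h hh hlt hhull hcov hdens x hx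
  have hlt1 : h < h₁ := hlt.trans_le ((min_le_left _ _).trans (min_le_left _ _))
  have hlt2 : h ≤ 1 := hlt.le.trans ((min_le_left _ _).trans (min_le_right _ _))
  have hlt3 : h ≤ δ / 64 := hlt.le.trans ((min_le_right _ _).trans (min_le_left _ _))
  have hlt4 : h ≤ ε / (L * C₂) :=
    hlt.le.trans ((min_le_right _ _).trans ((min_le_right _ _).trans (min_le_left _ _)))
  have hlt5 : h ≤ ε / (L * C₂ * C₂) :=
    hlt.le.trans ((min_le_right _ _).trans ((min_le_right _ _).trans (min_le_right _ _)))
  rw [le_div_iff₀ (by positivity)] at hlt4 hlt5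
  have hβ : 0 < γ / h ^ 2 := by positivity
  have hnode : ∀ y ∈ Ω, ∃ a : P, ‖(a : EuclideanSpace ℝ (Fin d)) - y‖ ≤ h := fun y hy => by
    obtain ⟨a, ha, hay⟩ := hcov.exists_norm_sub_le hy
    exact ⟨⟨a, ha⟩, hay⟩
  have hxh : x ∈ interior (convexHull ℝ (P : Set (EuclideanSpace ℝ (Fin d)))) := hhull ▸ hx
  have hP := nonempty_of_mem_interior_convexHull hxh
  have hPR : ∀ a ∈ P, ‖a‖ ≤ R := norm_le_of_interior_convexHull_subset ⟨x, hxh⟩ (hhull ▸ hR)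
  have hcardP := hcard P h hh hlt2 hdens hPR
  set X := Real.exp (-(γ * δ ^ 2 / 64 / h ^ 2)) with hX
  have hX0 : 0 < X := Real.exp_pos _
  have hNX : P.card * X ≤ η :=
    (mul_le_mul_of_nonneg_right hcardP hX0.le).trans (hsmall h hh hlt1)
  obtain ⟨z, hzx, hshape, hder⟩ := exists_gibbs_lmeShape hβ hxh
  obtain ⟨-, hder⟩ := hder fun a => φ a
  rw [hshape]
  set w := gibbs P (γ / h ^ 2) z with hw
  have hw0 : ∀ a, 0 ≤ w a := fun a => (gibbs_pos hP _ z a).le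
  by_cases hnear : ∃ y ∈ tsupport φ, ‖z - y‖ < δ
  · obtain ⟨y, hy, hzy⟩ := hnear
    have hzΩ : Metric.closedBall z (2 * h) ⊆ Ω := by
      refine (Metric.closedBall_subset_closedBall' ?_).trans (hball y hy)
      rw [dist_eq_norm]
      linarith
    obtain ⟨hm1, hm3, hcov⟩ := hmom P h Ω hP hh hdens hnode x z hzΩ hzx
    refine ⟨?_, fun f => ?_⟩
    · have h1 : ∑ a : P, φ a * w a - φ x = ∑ a : P, w a * (φ a - φ x) := by
        simp only [mul_sub, Finset.sum_sub_distrib, ← Finset.sum_mul]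
        rw [sum_gibbs hP, one_mul]
        simp only [mul_comm]
      rw [h1]
      calc |∑ a : P, w a * (φ a - φ x)| ≤ ∑ a : P, |w a * (φ a - φ x)| :=
            Finset.abs_sum_le_sum_abs _ _
        _ ≤ ∑ a : P, L * (w a * ‖(a : EuclideanSpace ℝ (Fin d)) - x‖) := by
            refine Finset.sum_le_sum fun a _ => ?_
            rw [abs_mul, abs_of_nonneg (hw0 a)]
            have := mul_le_mul_of_nonneg_left (hL x a).2.1 (hw0 a)
            linarith
        _ = L * ∑ a : P, w a * ‖(a : EuclideanSpace ℝ (Fin d)) - x‖ :=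
            (Finset.mul_sum _ _ _).symm
        _ ≤ L * (C₂ * h) := mul_le_mul_of_nonneg_left hm1 hL0.le
        _ ≤ ε := by linarith
    · obtain ⟨e, hef, hfd⟩ := hder f
      have he := hcov e f hef
      have h1 : fderiv ℝ φ x f = ∑ a : P, (w a * inner ℝ ((a : EuclideanSpace ℝ (Fin d)) - x) e) *
          fderiv ℝ φ x ((a : EuclideanSpace ℝ (Fin d)) - x) := by
        conv_lhs => rw [← hef, map_sum]
        simp only [map_smul, smul_eq_mul, hw]
      have h2 : ∑ a : P, (w a * inner ℝ ((a : EuclideanSpace ℝ (Fin d)) - x) e) * φ x = 0 := by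
        rw [← Finset.sum_mul, sum_gibbs_inner_sub hP hzx, zero_mul]
      -- The derivative formula is exact on affine functions: constants drop out because first
      -- moments vanish, and linear parts are reproduced because `Cov e = f`. Only the Taylor
      -- remainder is left.
      have h3 : ∑ a : P, φ a * (w a * inner ℝ ((a : EuclideanSpace ℝ (Fin d)) - x) e) -
          fderiv ℝ φ x f = ∑ a : P, (w a * inner ℝ ((a : EuclideanSpace ℝ (Fin d)) - x) e) *
            (φ a - φ x - fderiv ℝ φ x ((a : EuclideanSpace ℝ (Fin d)) - x)) := by
        simp only [mul_sub, Finset.sum_sub_distrib] at h1 h2 ⊢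
        rw [h2, ← h1, sub_zero]
        simp only [mul_comm]
      rw [hfd, h3]
      calc |∑ a : P, (w a * inner ℝ ((a : EuclideanSpace ℝ (Fin d)) - x) e) *
            (φ a - φ x - fderiv ℝ φ x ((a : EuclideanSpace ℝ (Fin d)) - x))|
          ≤ ∑ a : P, |(w a * inner ℝ ((a : EuclideanSpace ℝ (Fin d)) - x) e) *
            (φ a - φ x - fderiv ℝ φ x ((a : EuclideanSpace ℝ (Fin d)) - x))| :=
            Finset.abs_sum_le_sum_abs _ _
        _ ≤ ∑ a : P, (L * ‖e‖) * (w a * ‖(a : EuclideanSpace ℝ (Fin d)) - x‖ ^ 3) := by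
            refine Finset.sum_le_sum fun a _ => ?_
            rw [abs_mul, abs_mul, abs_of_nonneg (hw0 a)]
            calc w a * |inner ℝ ((a : EuclideanSpace ℝ (Fin d)) - x) e| *
                  |φ a - φ x - fderiv ℝ φ x ((a : EuclideanSpace ℝ (Fin d)) - x)|
                ≤ w a * (‖(a : EuclideanSpace ℝ (Fin d)) - x‖ * ‖e‖) *
                  (L * ‖(a : EuclideanSpace ℝ (Fin d)) - x‖ ^ 2) := by
                  refine mul_le_mul ?_ (hL x a).2.2 (abs_nonneg _)
                    (mul_nonneg (hw0 a) (by positivity))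
                  exact mul_le_mul_of_nonneg_left (abs_real_inner_le_norm _ _) (hw0 a)
              _ = _ := by ring
        _ = (L * ‖e‖) * ∑ a : P, w a * ‖(a : EuclideanSpace ℝ (Fin d)) - x‖ ^ 3 :=
            (Finset.mul_sum _ _ _).symm
        _ ≤ (L * ‖e‖) * (C₂ * h ^ 3) := mul_le_mul_of_nonneg_left hm3 (by positivity)
        _ = L * C₂ * h * (h ^ 2 * ‖e‖) := by ring
        _ ≤ L * C₂ * h * (C₂ * ‖f‖) := mul_le_mul_of_nonneg_left he (by positivity)
        _ = (h * (L * C₂ * C₂)) * ‖f‖ := by ring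
        _ ≤ ε * ‖f‖ := mul_le_mul_of_nonneg_right hlt5 (norm_nonneg f)
  · push Not at hnear
    -- Otherwise `x` itself would be a point of the support at distance at least `δ` from `z`, which
    -- is impossible for small `h`.
    have hxK : x ∉ tsupport φ := fun hxK => by
      have h1 := le_of_le_norm_sub_gibbsMean (D := 2 * R) hP hnode hβ.le hδ0 (by linarith)
        ((Metric.closedBall_subset_closedBall (by linarith)).trans (hball x hxK))
        (fun a => (norm_sub_le _ _).trans (by
          have h1 := hPR a a.2
          have h2 : ‖x‖ ≤ R := by simpa using hR hx
          linarith)) hzx (hnear x hxK)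
      have h2 : Real.exp (-(γ / h ^ 2 * δ ^ 2 / 16)) ≤ X := by
        refine Real.exp_le_exp.mpr (neg_le_neg ?_)
        have : γ * δ ^ 2 / 64 / h ^ 2 = γ / h ^ 2 * δ ^ 2 / 64 := by ring
        rw [this]
        have : 0 ≤ γ / h ^ 2 * δ ^ 2 := by positivity
        linarith
      have h3 : P.card * (2 * R) * Real.exp (-(γ / h ^ 2 * δ ^ 2 / 16)) ≤ δ / 8 := by
        calc _ ≤ P.card * (2 * R) * X := mul_le_mul_of_nonneg_left h2 (by positivity)
          _ = 2 * R * (P.card * X) := by ring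
          _ ≤ 2 * R * η := mul_le_mul_of_nonneg_left hNX (by positivity)
          _ ≤ δ / 8 := hη3
      linarith
    have hφx : φ x = 0 := image_eq_zero_of_notMem_tsupport hxK
    have hdφx : fderiv ℝ φ x = 0 :=
      image_eq_zero_of_notMem_tsupport fun hmem => hxK (tsupport_fderiv_subset ℝ hmem)
    have hsum : ∀ (g : P → ℝ) (B : ℝ), 0 ≤ B →
        (∀ a : P, (a : EuclideanSpace ℝ (Fin d)) ∈ tsupport φ → |g a| ≤ B * X) →
        |∑ a : P, φ a * g a| ≤ L * B * η := fun g B hB hg => by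
      calc |∑ a : P, φ a * g a| ≤ ∑ a : P, |φ a * g a| := Finset.abs_sum_le_sum_abs _ _
        _ ≤ ∑ a : P, L * (B * X) := by
            refine Finset.sum_le_sum fun a _ => ?_
            by_cases ha : (a : EuclideanSpace ℝ (Fin d)) ∈ tsupport φ
            · rw [abs_mul]
              exact mul_le_mul (hL a a).1 (hg a ha) (abs_nonneg _) hL0.le
            · rw [image_eq_zero_of_notMem_tsupport ha, zero_mul, abs_zero]
              positivity
        _ = L * B * (P.card * X) := by
            rw [Finset.sum_const, Finset.card_univ, Fintype.card_coe, nsmul_eq_mul]; ring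
        _ ≤ L * B * η := mul_le_mul_of_nonneg_left hNX (by positivity)
    have hballδ : ∀ a ∈ tsupport φ, Metric.closedBall a δ ⊆ Ω := fun a ha =>
      (Metric.closedBall_subset_closedBall (by linarith)).trans (hball a ha)
    have hX2 : Real.exp (-(γ / h ^ 2 * δ ^ 2 / 32)) = X ^ 2 := by
      rw [hX, pow_two (Real.exp _), ← Real.exp_add]; congr 1; ring
    have hX1 : X ≤ 1 := Real.exp_le_one_iff.mpr (neg_nonpos.mpr (by positivity))
    refine ⟨?_, fun f => ?_⟩
    · rw [hφx, sub_zero]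
      refine (hsum w 1 zero_le_one fun a ha => ?_).trans (by rwa [mul_one])
      obtain ⟨b, hb, -⟩ := gibbs_le_of_far (e := 0) hP hnode hβ.le hδ0 hlt3 (hballδ a ha)
        (by rw [norm_sub_rev]; exact hnear a ha) (by simp)
      have h1 := hb.trans (gibbs_le_one hP _ z b)
      have h2 : w a ≤ X ^ 2 := by
        rw [← hX2, Real.exp_neg, ← one_div, le_div_iff₀ (Real.exp_pos _)]
        exact h1
      rw [abs_of_nonneg (hw0 a), one_mul]
      nlinarith
    · obtain ⟨e, hef, hfd⟩ := hder f
      rw [hfd, hdφx, zero_apply, sub_zero]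
      refine (hsum _ (12 / δ * ‖f‖) (by positivity) fun a ha => ?_).trans ?_
      · have h1 := sq_gibbs_mul_inner_le_of_far hP hnode hβ.le hδ0 hlt3 (hballδ a ha)
          (by rw [norm_sub_rev]; exact hnear a ha) hef
        rw [hX2] at h1
        refine abs_le_of_sq_le_sq (h1.trans ?_) (by positivity)
        have e1 : (12 / δ * ‖f‖ * X) ^ 2 = 144 / δ ^ 2 * ‖f‖ ^ 2 * X ^ 2 := by ring
        rw [e1]
        gcongr
        norm_num
      · calc L * (12 / δ * ‖f‖) * η = (L * (12 / δ) * η) * ‖f‖ := by ring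
          _ ≤ ε * ‖f‖ := mul_le_mul_of_nonneg_right hη2 (norm_nonneg f)

end UniformApproximation

/-! ### From uniform approximation to density in the Sobolev norm. -/

section Density

variable {d : ℕ} {Ω : Set (EuclideanSpace ℝ (Fin d))} {p : ℝ≥0∞}

theorem IsOpenPolytope.isOpen (h : IsOpenPolytope Ω) : IsOpen Ω := by
  obtain ⟨V, rfl⟩ := h
  exact isOpen_interior

theorem IsOpenPolytope.isBounded (h : IsOpenPolytope Ω) : Bornology.IsBounded Ω := by
  obtain ⟨V, rfl⟩ := h
  exact (isBounded_convexHull.mpr V.finite_toSet.isBounded).subset interior_subset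

theorem mem_lmeSpace_sum (P : Finset (EuclideanSpace ℝ (Fin d))) (β : ℝ) (c : P → ℝ) :
    (fun y => ∑ a, c a * lmeShape P β y a) ∈ lmeSpace P β := by
  have : (fun y => ∑ a, c a * lmeShape P β y a) = ∑ a, c a • fun y => lmeShape P β y a := by
    ext y
    simp
  rw [this]
  exact Submodule.sum_mem _ fun a _ => Submodule.smul_mem _ _ (Submodule.subset_span ⟨a, rfl⟩)

theorem IsTestFunction.contDiffAt {φ : EuclideanSpace ℝ (Fin d) → ℝ} (hφ : IsTestFunction Ω φ)
    (x : EuclideanSpace ℝ (Fin d)) : ContDiffAt ℝ 1 φ x :=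
  (hφ.smooth.of_le (by norm_cast)).contDiffAt

theorem memW1p_of_uniform_bound (hΩo : IsOpen Ω) (hΩb : Bornology.IsBounded Ω)
    {v : EuclideanSpace ℝ (Fin d) → ℝ} (hv : ∀ x ∈ Ω, ContDiffAt ℝ 1 v x) {B : ℝ}
    (hB : ∀ x ∈ Ω, |v x| ≤ B ∧ ‖gradient v x‖ ≤ B) : MemW1p Ω p v := by
  have hw := hasWeakGradient_gradient hΩo hv
  have : IsFiniteMeasure (volume.restrict Ω) := ⟨by
    rw [Measure.restrict_apply_univ]; exact hΩb.measure_lt_top⟩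
  refine ⟨MemLp.of_bound hw.aestronglyMeasurable.1 B ?_, _, hw,
    MemLp.of_bound hw.aestronglyMeasurable.2 B ?_⟩
  · exact ae_restrict_of_forall_mem hΩo.measurableSet fun x hx => (hB x hx).1
  · exact ae_restrict_of_forall_mem hΩo.measurableSet fun x hx => (hB x hx).2

theorem w1pNorm_sub_le_of_uniform_bound (hΩo : IsOpen Ω)
    {v φ : EuclideanSpace ℝ (Fin d) → ℝ} (hv : ∀ x ∈ Ω, ContDiffAt ℝ 1 v x)
    (hφ : ∀ x ∈ Ω, ContDiffAt ℝ 1 φ x) {B : ℝ}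
    (hB : ∀ x ∈ Ω, |v x - φ x| ≤ B ∧ ‖gradient v x - gradient φ x‖ ≤ B) :
    w1pNorm Ω p (v - φ) ≤ 2 * (volume Ω ^ p.toReal⁻¹ * ENNReal.ofReal B) := by
  refine (w1pNorm_le ((hasWeakGradient_gradient hΩo hv).sub hΩo
    (hasWeakGradient_gradient hΩo hφ))).trans ?_
  have h1 := eLpNorm_le_of_ae_bound (p := p) (μ := volume.restrict Ω) (f := v - φ) (C := B)
    (ae_restrict_of_forall_mem hΩo.measurableSet fun x hx => (hB x hx).1)
  have h2 := eLpNorm_le_of_ae_bound (p := p) (μ := volume.restrict Ω)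
    (f := gradient v - gradient φ) (C := B)
    (ae_restrict_of_forall_mem hΩo.measurableSet fun x hx => (hB x hx).2)
  rw [Measure.restrict_apply_univ] at h1 h2
  rw [two_mul]
  exact add_le_add h1 h2

theorem norm_gradient_sub_le {v φ : EuclideanSpace ℝ (Fin d) → ℝ}
    {x : EuclideanSpace ℝ (Fin d)} {B : ℝ} (hB : 0 ≤ B)
    (h : ∀ f, |fderiv ℝ v x f - fderiv ℝ φ x f| ≤ B * ‖f‖) :
    ‖gradient v x - gradient φ x‖ ≤ B := by
  rw [gradient, gradient, ← map_sub, LinearIsometryEquiv.norm_map]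
  exact ContinuousLinearMap.opNorm_le_bound _ hB h

/-- Test functions are limits of combinations of LME shape functions. -/
theorem eventually_exists_lmeSpace_w1pNorm_sub_lt (hΩ : IsOpenPolytope Ω)
    {P : ℕ → Finset (EuclideanSpace ℝ (Fin d))} {h : ℕ → ℝ} {γ τ : ℝ}
    (hγ : 0 < γ) (hτ : 0 < τ) (hpos : ∀ k, 0 < h k) (hlim : Tendsto h atTop (𝓝 0))
    (hhull : ∀ k, interior (convexHull ℝ (P k : Set (EuclideanSpace ℝ (Fin d)))) = Ω)
    (hcov : ∀ k, IsHCovering (P k : Set (EuclideanSpace ℝ (Fin d))) (h k) Ω)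
    (hdens : ∀ k, HasHDensityLE (P k) (h k) τ)
    {φ : EuclideanSpace ℝ (Fin d) → ℝ} (hφ : IsTestFunction Ω φ)
    {ε : ℝ≥0∞} (hε : 0 < ε) :
    ∀ᶠ k in atTop, ∃ v, (v ∈ lmeSpace (P k) (γ / h k ^ 2) ∧ MemW1p Ω p v) ∧
      w1pNorm Ω p (v - φ) < ε := by
  have hΩo := hΩ.isOpen
  have hΩb := hΩ.isBounded
  have hlimB : Tendsto (fun B : ℝ => 2 * (volume Ω ^ p.toReal⁻¹ * ENNReal.ofReal B))
      (𝓝[>] 0) (𝓝 0) := by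
    have h1 : Tendsto ENNReal.ofReal (𝓝[>] 0) (𝓝 0) := by
      have := (ENNReal.continuous_ofReal.tendsto 0).mono_left
        (nhdsWithin_le_nhds (s := Set.Ioi (0 : ℝ)))
      rwa [ENNReal.ofReal_zero] at this
    have h2 : volume Ω ^ p.toReal⁻¹ ≠ ⊤ :=
      ENNReal.rpow_ne_top_of_nonneg (inv_nonneg.mpr ENNReal.toReal_nonneg)
        hΩb.measure_lt_top.ne
    have h3 := ENNReal.Tendsto.const_mul (a := 2)
      (ENNReal.Tendsto.const_mul h1 (Or.inr h2)) (Or.inr ENNReal.ofNat_ne_top)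
    simpa using h3
  obtain ⟨B, hBε, hB0⟩ := ((hlimB.eventually (Iio_mem_nhds hε)).and self_mem_nhdsWithin).exists
  have hB0 : 0 < B := hB0
  obtain ⟨h₀, hh₀, happ⟩ := exists_uniform_approx hΩo hΩb hφ hγ hτ hB0
  filter_upwards [hlim.eventually (Iio_mem_nhds hh₀)] with k hk
  have hu := happ (P k) (h k) (hpos k) hk (hhull k) (hcov k) (hdens k)
  set v := fun y => ∑ a : P k, φ a * lmeShape (P k) (γ / h k ^ 2) y a with hv
  have hvC : ∀ x ∈ Ω, ContDiffAt ℝ 1 v x := fun x hx => by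
    have hβ : 0 < γ / h k ^ 2 := by have := hpos k; positivity
    obtain ⟨z, -, -, hd⟩ := exists_gibbs_lmeShape hβ ((hhull k).symm ▸ hx)
    exact (hd fun a => φ a).1
  have hbound : ∀ x ∈ Ω, |v x - φ x| ≤ B ∧ ‖gradient v x - gradient φ x‖ ≤ B := fun x hx =>
    ⟨(hu x hx).1, norm_gradient_sub_le hB0.le (hu x hx).2⟩
  obtain ⟨M, hM⟩ := hφ.smooth.continuous.bounded_above_of_compact_support hφ.hasCompactSupport
  obtain ⟨M', hM'⟩ := (hφ.smooth.continuous_fderiv (by simp)).bounded_above_of_compact_support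
    (hφ.hasCompactSupport.fderiv ℝ)
  refine ⟨v, ⟨mem_lmeSpace_sum _ _ _, ?_⟩, lt_of_le_of_lt
    (w1pNorm_sub_le_of_uniform_bound hΩo hvC (fun x _ => hφ.contDiffAt x) hbound) hBε⟩
  refine memW1p_of_uniform_bound hΩo hΩb hvC (B := max (B + M) (B + M')) fun x hx => ⟨?_, ?_⟩
  · have h1 := (hbound x hx).1
    have h2 := hM x
    have h3 := abs_add_le (v x - φ x) (φ x)
    rw [sub_add_cancel] at h3
    rw [Real.norm_eq_abs] at h2
    exact le_max_of_le_left (by linarith)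
  · have h1 := (hbound x hx).2
    have h2 : ‖gradient φ x‖ ≤ M' := by
      rw [gradient, LinearIsometryEquiv.norm_map]; exact hM' x
    have h3 := norm_le_norm_sub_add (gradient v x) (gradient φ x)
    exact le_max_of_le_right (by linarith)

theorem memW1p_zero : MemW1p Ω p (0 : EuclideanSpace ℝ (Fin d) → ℝ) :=
  ⟨MemLp.zero, 0, HasWeakGradient.zero, MemLp.zero⟩

end Density

end LMEDensity

theorem mainTheorem7 {d : ℕ} (Ω : Set (EuclideanSpace ℝ (Fin d)))
    (hΩ : LMEDensity.IsOpenPolytope Ω)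
    (P : ℕ → Finset (EuclideanSpace ℝ (Fin d))) (h : ℕ → ℝ) (γ τ : ℝ)
    (hγ : 0 < γ) (hτ : 0 < τ)
    (hpos : ∀ k, 0 < h k) (hlim : Tendsto h atTop (𝓝 0))
    (hhull : ∀ k, interior (convexHull ℝ (P k : Set (EuclideanSpace ℝ (Fin d)))) = Ω)
    (hcov : ∀ k, LMEDensity.IsHCovering (P k : Set (EuclideanSpace ℝ (Fin d))) (h k) Ω)
    (hdens : ∀ k, LMEDensity.HasHDensityLE (P k) (h k) τ)
    (p : ℝ≥0∞) (hp : 1 ≤ p) (hp' : p ≠ ⊤)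
    (u : EuclideanSpace ℝ (Fin d) → ℝ) (hu : LMEDensity.MemW1p0 Ω p u) :
    ∃ v : ℕ → EuclideanSpace ℝ (Fin d) → ℝ,
      (∀ k, v k ∈ LMEDensity.lmeSpace (P k) (γ / h k ^ 2) ∧ LMEDensity.MemW1p Ω p (v k)) ∧
      Tendsto (fun k => LMEDensity.w1pNorm Ω p (v k - u)) atTop (𝓝 0) := by
  set S : ℕ → Set (EuclideanSpace ℝ (Fin d) → ℝ) := fun k =>
    {v | v ∈ LMEDensity.lmeSpace (P k) (γ / h k ^ 2) ∧ LMEDensity.MemW1p Ω p v} with hS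
  -- The distance from `u` to the `k`-th space. Choosing almost-minimizers for each `k` yields one
  -- sequence that does not depend on the test function, and replaces a diagonal argument.
  set E : ℕ → ℝ≥0∞ := fun k => ⨅ v ∈ S k, LMEDensity.w1pNorm Ω p (v - u) with hE
  have hEε : ∀ ε : ℝ≥0∞, 0 < ε → ∀ᶠ k in atTop, E k < ε := fun ε hε => by
    obtain ⟨φ, hφ, hφu⟩ := hu.2 (ε / 2) (ENNReal.half_pos hε.ne')
    filter_upwards [LMEDensity.eventually_exists_lmeSpace_w1pNorm_sub_lt (p := p) hΩ hγ hτ hpos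
      hlim hhull hcov hdens hφ (ENNReal.half_pos hε.ne')] with k hk
    obtain ⟨v, hv, hvφ⟩ := hk
    refine lt_of_le_of_lt (iInf₂_le v hv) ?_
    have hsplit : v - u = (v - φ) - (u - φ) := by abel
    rw [hsplit]
    calc LMEDensity.w1pNorm Ω p (v - φ - (u - φ))
        ≤ LMEDensity.w1pNorm Ω p (v - φ) + LMEDensity.w1pNorm Ω p (u - φ) :=
          LMEDensity.w1pNorm_sub_le hΩ.isOpen hp _ _
      _ < ε / 2 + ε / 2 := ENNReal.add_lt_add hvφ hφu
      _ = ε := ENNReal.add_halves ε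
  have hE0 : Tendsto E atTop (𝓝 0) := ENNReal.tendsto_nhds_zero.mpr fun ε hε =>
    (hEε ε hε).mono fun k hk => hk.le
  have hchoose : ∀ k : ℕ, ∃ v ∈ S k,
      LMEDensity.w1pNorm Ω p (v - u) ≤ E k + ((k : ℝ≥0∞) + 1)⁻¹ := fun k => by
    -- An infinite distance admits no strictly larger value, so the case is settled with the zero
    -- function.
    by_cases htop : E k = ⊤
    · exact ⟨0, ⟨Submodule.zero_mem _, LMEDensity.memW1p_zero⟩, by simp [htop]⟩
    · have hlt : E k < E k + ((k : ℝ≥0∞) + 1)⁻¹ :=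
        ENNReal.lt_add_right htop (by simp)
      obtain ⟨v, hv⟩ := iInf_lt_iff.mp hlt
      obtain ⟨hvS, hv⟩ := iInf_lt_iff.mp hv
      exact ⟨v, hvS, hv.le⟩
  choose v hvS hv using hchoose
  refine ⟨v, hvS, ?_⟩
  have hinv : Tendsto (fun k : ℕ => ((k : ℝ≥0∞) + 1)⁻¹) atTop (𝓝 0) := by
    have := (tendsto_add_atTop_iff_nat 1).mpr ENNReal.tendsto_inv_nat_nhds_zero
    simpa using this
  have hsum := hE0.add hinv
  rw [add_zero] at hsum
  exact tendsto_of_tendsto_of_tendsto_of_le_of_le tendsto_const_nhds hsum (fun _ => zero_le)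
    hv
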